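/- Directed Steiner Forest is the following minimization problem. The input is a finite digraph $G=(V,E)$ and a set $T\subseteq V\times V$ of terminal pairs. A solution is a set $E'\subseteq E$ such that $(V,E')$ contains a directed path from $s$ to $t$ for every $(s,t)\in T$; its cost is $|E'|$. Let $\mathrm{OPT}$ be the minimum cost of a solution. For every constant $\varepsilon>0$, Directed Steiner Forest admits an $\mathrm{OPT}^{1+\varepsilon}$-approximation in polynomial time: there is an algorithm that halts on every input after a number of steps bounded by a polynomial in the input size (the polynomial depending only on $\varepsilon$) and that, whenever the input has a solution, outputs a solution $E'$ with $|E'|\le \mathrm{OPT}^{1+\varepsilon}\cdot \mathrm{OPT}$. -/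

import Mathlib

/-! ### Random access machines

The machine model is the unit-cost random access machine on natural numbers with addition and
truncated subtraction (and without multiplication), written with structured control flow.  A
program mentions only finitely many registers and arrays.  Polynomial time on this model agrees
with polynomial time on Turing machines: one step lengthens the numbers by at most one bit. -/

namespace RAM

/-- The content of the machine: registers, and unbounded arrays `arr 0, arr 1, …`. -/
structure State where
  reg : ℕ → ℕ
  arr : ℕ → ℕ → ℕ

/-- Expressions: constants, registers, array cells (indirect addressing), sums, and truncated
differences. -/
inductive Expr where
  | const (c : ℕ)
  | reg (x : ℕ)
  | get (a : ℕ) (i : Expr)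
  | add (e₁ e₂ : Expr)
  | sub (e₁ e₂ : Expr)

/-- The value of an expression. -/
def Expr.eval (s : State) : Expr → ℕ
  | .const c => c
  | .reg x => s.reg x
  | .get a i => s.arr a (i.eval s)
  | .add e₁ e₂ => e₁.eval s + e₂.eval s
  | .sub e₁ e₂ => e₁.eval s - e₂.eval s

/-- The number of steps needed to evaluate an expression: one for each operation. -/
def Expr.cost : Expr → ℕ
  | .const _ => 1
  | .reg _ => 1
  | .get _ i => i.cost + 1
  | .add e₁ e₂ => e₁.cost + e₂.cost + 1
  | .sub e₁ e₂ => e₁.cost + e₂.cost + 1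

/-- Programs.  Conditionals and loops test whether an expression is nonzero. -/
inductive Prog where
  | skip
  | assign (x : ℕ) (e : Expr)
  | store (a : ℕ) (i e : Expr)
  | seq (P Q : Prog)
  | cond (e : Expr) (P Q : Prog)
  | loop (e : Expr) (P : Prog)

/-- `x := v` -/
def State.setReg (s : State) (x v : ℕ) : State :=
  { s with reg := Function.update s.reg x v }

/-- `arr a [i] := v` -/
def State.setArr (s : State) (a i v : ℕ) : State :=
  { s with arr := Function.update s.arr a (Function.update (s.arr a) i v) }

/-- `P.Exec s t s'`: started in state `s`, the program `P` halts after exactly `t` steps, in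
state `s'`. -/
inductive Prog.Exec : Prog → State → ℕ → State → Prop
  | skip (s : State) : Exec .skip s 1 s
  | assign (x : ℕ) (e : Expr) (s : State) :
      Exec (.assign x e) s (e.cost + 1) (s.setReg x (e.eval s))
  | store (a : ℕ) (i e : Expr) (s : State) :
      Exec (.store a i e) s (i.cost + e.cost + 1) (s.setArr a (i.eval s) (e.eval s))
  | seq {P Q : Prog} {s s' s'' : State} {t t' : ℕ} :
      Exec P s t s' → Exec Q s' t' s'' → Exec (.seq P Q) s (t + t') s''
  | cond_true {e : Expr} {P Q : Prog} {s s' : State} {t : ℕ} :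
      e.eval s ≠ 0 → Exec P s t s' → Exec (.cond e P Q) s (e.cost + 1 + t) s'
  | cond_false {e : Expr} {P Q : Prog} {s s' : State} {t : ℕ} :
      e.eval s = 0 → Exec Q s t s' → Exec (.cond e P Q) s (e.cost + 1 + t) s'
  | loop_true {e : Expr} {P : Prog} {s s' s'' : State} {t t' : ℕ} :
      e.eval s ≠ 0 → Exec P s t s' → Exec (.loop e P) s' t' s'' →
      Exec (.loop e P) s (e.cost + 1 + t + t') s''
  | loop_false {e : Expr} {P : Prog} {s : State} :
      e.eval s = 0 → Exec (.loop e P) s (e.cost + 1) s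

/-- Programs are deterministic: the running time and the final state are unique. -/
theorem Prog.Exec.unique {P : Prog} {s s₁ s₂ : State} {t₁ t₂ : ℕ}
    (h₁ : P.Exec s t₁ s₁) (h₂ : P.Exec s t₂ s₂) : t₁ = t₂ ∧ s₁ = s₂ := by
  induction h₁ generalizing t₂ s₂ with
  | skip | assign | store => cases h₂; exact ⟨rfl, rfl⟩
  | seq _ _ ihP ihQ =>
    cases h₂ with
    | seq hP hQ =>
      obtain ⟨rfl, rfl⟩ := ihP hP
      obtain ⟨rfl, rfl⟩ := ihQ hQ
      exact ⟨rfl, rfl⟩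
  | cond_true he _ ih =>
    cases h₂ with
    | cond_true _ h => obtain ⟨rfl, rfl⟩ := ih h; exact ⟨rfl, rfl⟩
    | cond_false h0 _ => exact absurd h0 he
  | cond_false he _ ih =>
    cases h₂ with
    | cond_true h0 _ => exact absurd he h0
    | cond_false _ h => obtain ⟨rfl, rfl⟩ := ih h; exact ⟨rfl, rfl⟩
  | loop_true he _ _ ihP ihL =>
    cases h₂ with
    | loop_true _ hP hL =>
      obtain ⟨rfl, rfl⟩ := ihP hP
      obtain ⟨rfl, rfl⟩ := ihL hL
      exact ⟨rfl, rfl⟩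
    | loop_false h0 => exact absurd h0 he
  | loop_false he =>
    cases h₂ with
    | loop_true h0 _ _ => exact absurd he h0
    | loop_false _ => exact ⟨rfl, rfl⟩

open Classical in
/-- The 0-1 matrix of a relation on `Fin n`, stored row by row in an array (0 elsewhere). -/
noncomputable def matrixArray (n : ℕ) (R : Fin n → Fin n → Prop) : ℕ → ℕ := fun a =>
  if ∃ u v : Fin n, a = u * n + v ∧ R u v then 1 else 0

/-- The set of pairs at which a matrix stored row by row in an array is nonzero. -/
def pairsOfArray (n : ℕ) (A : ℕ → ℕ) : Finset (Fin n × Fin n) :=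
  Finset.univ.filter fun e => A (e.1 * n + e.2) ≠ 0

end RAM

/-! ### Directed Steiner Forest -/

/-- An instance of Directed Steiner Forest: a digraph and a set of terminal pairs `(s, t)`. -/
structure DirectedSteinerForest (V : Type*) where
  graph : Digraph V
  terminals : Finset (V × V)

namespace DirectedSteinerForest

/-- A solution is a set `F` of edges of the digraph such that `(V, F)` contains a directed path
from `s` to `t` for every terminal pair `(s, t)`. -/
def IsSolution {V : Type*} (I : DirectedSteinerForest V) (F : Finset (V × V)) : Prop :=
  (∀ e ∈ F, I.graph.Adj e.1 e.2) ∧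
    ∀ p ∈ I.terminals, Relation.ReflTransGen (fun u v => (u, v) ∈ F) p.1 p.2

/-- The least number of edges in a solution (meaningful only if there is a solution). -/
noncomputable def opt {V : Type*} (I : DirectedSteinerForest V) : ℕ :=
  sInf {c | ∃ F, I.IsSolution F ∧ F.card = c}

/-- The initial state of a machine on the input `I`: the number of vertices is in register 0,
the adjacency matrix in array 0, the matrix of the terminal pairs in array 1, all other registers
and arrays are 0. -/
noncomputable def initialState {n : ℕ} (I : DirectedSteinerForest (Fin n)) : RAM.State where
  reg x := if x = 0 then n else 0
  arr a :=
    if a = 0 then RAM.matrixArray n I.graph.Adj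
    else if a = 1 then RAM.matrixArray n fun u v => (u, v) ∈ I.terminals
    else fun _ => 0

end DirectedSteinerForest

/-!
A terminal pair is nontrivial if its two vertices differ.  In a solution with `m = OPT` edges, the
source of a nontrivial pair has an outgoing edge, and its target has an incoming edge.  So there
are at most `m` sources with nontrivial targets, and each of them has an out-tree with at most `m`
edges to its at most `m` targets.  It therefore suffices to buy, for each source, an out-tree
that costs at most `m ^ (1 + ε)`: a constant-depth recursive greedy algorithm for Directed Steiner
Tree does this when `m` is large, and when `m` is bounded an exhaustive search finds an optimal
solution.

The greedy algorithm with `k + 1` levels and root `v` repeats the following step `R` times: among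
all vertices `u` at distance at most `cap (k + 1)` from `v`, buy a shortest path to `u`, run `k`
levels with root `u`, and keep the best result, that is, one that leaves the fewest targets
unsatisfied.  An out-tree with at most `cap (k + 1)` edges splits into `q + 1` pieces with at most
`cap k` edges each (`Arborescence.split`, `splits_min`, `splits_zero`), where
`cap k` is about `2 * cap (k + 1) / q`.  One of the pieces contains a `1 / (q + 1)` fraction of the
targets still missing, so every step decreases their number by the factor `q / (q + 1)`
(`Steps.succ`), and after `R` steps none of them is missing (`Steps.improves`).  With
`q ≈ m ^ (1 / ℓ)`, with `R` slightly larger than `q`, and with `ℓ + 1` levels, the cost is about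
`R ^ (ℓ + 1)`, which is at most `m ^ (1 + ε)` for large `ℓ` and `m` (`exists_parameters`).

The algorithm does not know `m`.  It runs through all values of the parameters `R`, `cap k` and of
the edges for the exhaustive search, and keeps the smallest solution it meets (`algorithm_run`).
For fixed `ε` these are boundedly many numbers below the number `n` of vertices, so the running time
is polynomial.

To verify the running time and the correctness separately, the algorithm is written in a small
language of programs on `n × n` matrices, in which all loops run over the `n` vertices.  A program
of this language denotes a total function (`Cmd.run`), and is compiled to code for the random access
machine that computes this function in polynomial time (`Cmd.runs_code`).  What remains is to prove
properties of functions on matrices.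
-/

namespace RAM

/-- `P` halts on `s` within `T` steps, in a state satisfying `Q`. -/
def Prog.Runs (P : Prog) (s : State) (T : ℕ) (Q : State → Prop) : Prop :=
  ∃ t s', P.Exec s t s' ∧ t ≤ T ∧ Q s'

theorem Prog.Runs.mono {P : Prog} {s : State} {T T' : ℕ} {Q Q' : State → Prop}
    (h : P.Runs s T Q) (hT : T ≤ T') (hQ : ∀ s', Q s' → Q' s') : P.Runs s T' Q' := by
  obtain ⟨t, s', he, ht, hq⟩ := h
  exact ⟨t, s', he, ht.trans hT, hQ _ hq⟩

theorem Prog.Runs.seq {P P' : Prog} {s : State} {T T' : ℕ} {Q Q' : State → Prop}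
    (h : P.Runs s T Q) (h' : ∀ s', Q s' → P'.Runs s' T' Q') :
    (Prog.seq P P').Runs s (T + T') Q' := by
  obtain ⟨t, s', he, ht, hq⟩ := h
  obtain ⟨t', s'', he', ht', hq'⟩ := h' s' hq
  exact ⟨t + t', s'', .seq he he', by omega, hq'⟩

theorem Prog.runs_assign {x : ℕ} {e : Expr} {s : State} {T : ℕ} {Q : State → Prop}
    (hT : e.cost + 1 ≤ T) (h : Q (s.setReg x (e.eval s))) : (Prog.assign x e).Runs s T Q :=
  ⟨_, _, .assign x e s, hT, h⟩

theorem Prog.runs_store {a : ℕ} {i e : Expr} {s : State} {T : ℕ} {Q : State → Prop}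
    (hT : i.cost + e.cost + 1 ≤ T) (h : Q (s.setArr a (i.eval s) (e.eval s))) :
    (Prog.store a i e).Runs s T Q :=
  ⟨_, _, .store a i e s, hT, h⟩

theorem Prog.runs_cond {e : Expr} {P P' : Prog} {s : State} {T : ℕ} {Q : State → Prop}
    (h : e.eval s ≠ 0 → P.Runs s T Q) (h' : e.eval s = 0 → P'.Runs s T Q) :
    (Prog.cond e P P').Runs s (e.cost + 1 + T) Q := by
  by_cases he : e.eval s = 0
  · obtain ⟨t, s', hx, ht, hq⟩ := h' he
    exact ⟨_, s', .cond_false he hx, by omega, hq⟩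
  · obtain ⟨t, s', hx, ht, hq⟩ := h he
    exact ⟨_, s', .cond_true he hx, by omega, hq⟩

@[simp] theorem State.setReg_arr (s : State) (x v : ℕ) : (s.setReg x v).arr = s.arr := rfl
@[simp] theorem State.setArr_reg (s : State) (a i v : ℕ) : (s.setArr a i v).reg = s.reg := rfl

theorem State.setReg_reg (s : State) (x v y : ℕ) :
    (s.setReg x v).reg y = if y = x then v else s.reg y := by
  simp [State.setReg, Function.update_apply]

theorem State.setArr_arr (s : State) (a i v b j : ℕ) :
    (s.setArr a i v).arr b j = if b = a ∧ j = i then v else s.arr b j := by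
  simp only [State.setArr, Function.update_apply]
  by_cases hb : b = a
  · subst hb; simp [Function.update_apply]
  · simp [hb]

/-! ### Counting loops -/

/-- `s'` agrees with `s` on the registers that a piece of code with scratch space `d` may not
change: register 0, the variables (odd registers), and the scratch registers below level `d`
(the scratch register of level `e` is register `2 * e + 2`). -/
def Frame (d : ℕ) (s s' : State) : Prop :=
  ∀ r, r % 2 = 1 ∨ r < 2 * d + 2 → s'.reg r = s.reg r

theorem Frame.refl (d : ℕ) (s : State) : Frame d s s := fun _ _ => rfl

theorem Frame.trans {d : ℕ} {s s' s'' : State} (h : Frame d s s') (h' : Frame d s' s'') :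
    Frame d s s'' := fun r hr => (h' r hr).trans (h r hr)

theorem Frame.mono {d e : ℕ} {s s' : State} (h : Frame e s s') (hde : d ≤ e) : Frame d s s' :=
  fun r hr => h r (by omega)

theorem Frame.setReg {d e : ℕ} {s s' : State} (h : Frame d s s') (hde : d ≤ e) (v : ℕ) :
    Frame d s (s'.setReg (2 * e + 2) v) := fun r hr => by
  rw [State.setReg_reg, if_neg (by omega)]; exact h r hr

theorem Frame.setArr {d : ℕ} {s s' : State} (h : Frame d s s') (a i v : ℕ) :
    Frame d s (s'.setArr a i v) := h

/-- `for x = 0, …, n - 1 do P`, where `n` is in register 0; the old value of `x` is kept in the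
register `y` meanwhile. -/
def Prog.forVar (x y : ℕ) (P : Prog) : Prog :=
  .seq (.assign y (.reg x)) <| .seq (.assign x (.const 0)) <|
    .seq (.loop (.sub (.reg 0) (.reg x)) (.seq P (.assign x (.add (.reg x) (.const 1)))))
      (.assign x (.reg y))

/-- Total correctness of a counting loop from an invariant. -/
theorem Prog.runs_loop_of_invariant {n x T : ℕ} {P : Prog} (K : ℕ → State → Prop)
    (hK : ∀ k s, K k s → s.reg 0 = n ∧ s.reg x = k)
    (hP : ∀ k, k < n → ∀ s, K k s → P.Runs s T fun s' => s'.reg x = k ∧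
      K (k + 1) (s'.setReg x (k + 1)))
    (j : ℕ) : ∀ k, k + j = n → ∀ s, K k s →
      (Prog.loop (.sub (.reg 0) (.reg x)) (.seq P (.assign x (.add (.reg x) (.const 1))))).Runs s
        (j * (T + 8) + 4) (K n) := by
  induction j with
  | zero =>
    intro k hk s hs
    obtain ⟨h0, hx⟩ := hK k s hs
    obtain rfl : k = n := by omega
    refine ⟨_, s, .loop_false ?_, ?_, hs⟩
    · simp [Expr.eval, h0, hx]
    · simp [Expr.cost]
  | succ j ih =>
    intro k hk s hs
    obtain ⟨h0, hx⟩ := hK k s hs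
    obtain ⟨t, s', he, ht, hx', hs'⟩ := hP k (by omega) s hs
    obtain ⟨t', s'', he', ht', hs''⟩ := ih (k + 1) (by omega) _ hs'
    have ha := Exec.assign x (.add (.reg x) (.const 1)) s'
    have hv : (Expr.add (.reg x) (.const 1)).eval s' = k + 1 := by simp [Expr.eval, hx']
    rw [hv] at ha
    refine ⟨_, s'', .loop_true ?_ (.seq he ha) he', ?_, hs''⟩
    · simp [Expr.eval, h0, hx]; omega
    · simp only [Expr.cost]
      have : (j + 1) * (T + 8) = j * (T + 8) + (T + 8) := by ring
      omega

/-- A counting loop over the variable `i`, saving its old value in the scratch register of level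
`e`.  The invariant `J k`, which holds after `k` iterations, may not depend on these two
registers. -/
theorem Prog.runs_forVar {n d e i T : ℕ} {P : Prog} {s : State} (hde : d ≤ e)
    (h0 : s.reg 0 = n) (J : ℕ → State → Prop)
    (hJ : ∀ k s₁ r v, r = 2 * i + 1 ∨ r = 2 * e + 2 → J k s₁ → J k (s₁.setReg r v))
    (hJ0 : J 0 s)
    (hP : ∀ k, k < n → ∀ s₁, Frame d (s.setReg (2 * i + 1) k) s₁ → J k s₁ →
      P.Runs s₁ T fun s₂ => Frame (e + 1) s₁ s₂ ∧ J (k + 1) s₂) :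
    (Prog.forVar (2 * i + 1) (2 * e + 2) P).Runs s (n * (T + 8) + 12)
      fun s' => Frame d s s' ∧ J n s' := by
  set K : ℕ → State → Prop := fun k s₁ =>
    Frame d (s.setReg (2 * i + 1) k) s₁ ∧ s₁.reg (2 * e + 2) = s.reg (2 * i + 1) ∧ J k s₁ with hKdef
  have hK : ∀ k s₁, K k s₁ → s₁.reg 0 = n ∧ s₁.reg (2 * i + 1) = k := by
    rintro k s₁ ⟨hf, -, -⟩
    refine ⟨?_, ?_⟩
    · rw [hf 0 (by omega), State.setReg_reg, if_neg (by omega), h0]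
    · rw [hf _ (by omega), State.setReg_reg, if_pos rfl]
  have hloop := fun s₁ h => Prog.runs_loop_of_invariant (P := P) (T := T) (x := 2 * i + 1) K hK
    (by
      rintro k hk s₁ hs₁
      obtain ⟨hf, hsave, hj⟩ := hs₁
      refine (hP k hk s₁ hf hj).mono le_rfl ?_
      rintro s₂ ⟨hf', hj'⟩
      refine ⟨?_, ?_, ?_, hJ _ _ _ _ (Or.inl rfl) hj'⟩
      · rw [hf' _ (by omega)]; exact (hK k s₁ ⟨hf, hsave, hj⟩).2
      · intro r hr
        rw [State.setReg_reg, State.setReg_reg]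
        split_ifs with h
        · rfl
        · rw [hf' r (by omega), hf r hr, State.setReg_reg, if_neg h]
      · rw [State.setReg_reg, if_neg (by omega), hf' _ (by omega), hsave]) n 0 (by omega) s₁ h
  have h1 : (Prog.forVar (2 * i + 1) (2 * e + 2) P).Runs s (2 + (2 + ((n * (T + 8) + 4) + 2)))
      fun s' => Frame d s s' ∧ J n s' := by
    refine Prog.Runs.seq (Q := fun s' => s' = s.setReg (2 * e + 2) (s.reg (2 * i + 1)))
      (Prog.runs_assign (by simp [Expr.cost]) rfl) ?_
    rintro _ rfl
    refine Prog.Runs.seq (Q := K 0) (Prog.runs_assign (by simp [Expr.cost]) ⟨?_, ?_, ?_⟩) ?_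
    · intro r hr
      simp only [State.setReg_reg, Expr.eval]
      split_ifs <;> first | rfl | omega
    · simp only [State.setReg_reg]
      split_ifs <;> first | rfl | omega
    · exact hJ _ _ _ _ (Or.inl rfl) (hJ _ _ _ _ (Or.inr rfl) hJ0)
    · intro s₁ hs₁
      refine Prog.Runs.seq (hloop s₁ hs₁) ?_
      rintro s₂ ⟨hf, hsave, hj⟩
      refine Prog.runs_assign (by simp [Expr.cost]) ⟨?_, hJ _ _ _ _ (Or.inl rfl) hj⟩
      intro r hr
      simp only [State.setReg_reg, Expr.eval]
      split_ifs with h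
      · rw [hsave, h]
      · rw [hf r hr, State.setReg_reg, if_neg h]
  exact h1.mono (by omega) fun _ h => h

end RAM

/-! ### A language of matrix programs -/

namespace MatrixProgram

open RAM

/-- Terms of the matrix language.  Variables range over the vertices `0, …, n - 1`, and
`entry a x y` is the entry of the matrix number `a` at the vertices `x`, `y`. -/
inductive Term where
  | const (c : ℕ)
  | var (x : ℕ)
  | entry (a x y : ℕ)
  | add (e₁ e₂ : Term)
  | sub (e₁ e₂ : Term)
  | ite (c e₁ e₂ : Term)
  | sum (x : ℕ) (e : Term)

/-- A store: a sequence of `n × n` matrices of natural numbers. -/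
abbrev Store (n : ℕ) : Type := ℕ → Fin n → Fin n → ℕ

/-- An environment: the values of the variables. -/
abbrev Env (n : ℕ) : Type := ℕ → Fin n

/-- The value of a term; `sum x e` is the sum of `e` over all vertices `x`. -/
def Term.val {n : ℕ} (σ : Store n) : Env n → Term → ℕ
  | _, .const c => c
  | ρ, .var x => ρ x
  | ρ, .entry a x y => σ a (ρ x) (ρ y)
  | ρ, .add e₁ e₂ => e₁.val σ ρ + e₂.val σ ρ
  | ρ, .sub e₁ e₂ => e₁.val σ ρ - e₂.val σ ρ
  | ρ, .ite c e₁ e₂ => if c.val σ ρ ≠ 0 then e₁.val σ ρ else e₂.val σ ρ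
  | ρ, .sum x e => ∑ i, e.val σ (Function.update ρ x i)

/-- Commands of the matrix language. -/
inductive Cmd where
  | skip
  | assign (a : ℕ) (e : Term)
  | seq (S S' : Cmd)
  | when (c : Term) (S : Cmd)
  | each (x : ℕ) (S : Cmd)

/-- The effect of a command on the store.  `assign a e` replaces all entries of the matrix `a`
simultaneously by the values of `e`, where the variables 0 and 1 stand for the row and the column;
`each x S` executes `S` for `x = 0, …, n - 1`. -/
def Cmd.run {n : ℕ} : Cmd → Env n → Store n → Store n
  | .skip, _, σ => σ
  | .assign a e, ρ, σ =>
      Function.update σ a fun u v => e.val σ (Function.update (Function.update ρ 0 u) 1 v)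
  | .seq S S', ρ, σ => S'.run ρ (S.run ρ σ)
  | .when c S, ρ, σ => if c.val σ ρ ≠ 0 then S.run ρ σ else σ
  | .each x S, ρ, σ => (List.finRange n).foldl (fun σ i => S.run (Function.update ρ x i) σ) σ

/-! ### Compilation to the random access machine -/

/-- The array in which the matrix `a` is stored.  The array 3 is a buffer, and the array 4 holds
the multiples of `n`. -/
def slot (a : ℕ) : ℕ := if a < 3 then a else a + 2

theorem slot_injective : Function.Injective slot := by
  intro a b h
  unfold slot at h
  split_ifs at h <;> omega

theorem slot_ne_three (a : ℕ) : slot a ≠ 3 := by unfold slot; split_ifs <;> omega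
theorem slot_ne_four (a : ℕ) : slot a ≠ 4 := by unfold slot; split_ifs <;> omega

/-- The position in an array of the matrix entry at the variables `x`, `y`. -/
def position (x y : ℕ) : Expr := .add (.get 4 (.reg (2 * x + 1))) (.reg (2 * y + 1))

/-- The machine code of a term: it leaves the value in the scratch register of level `d` and uses
no scratch registers of lower level. -/
def Term.code : Term → ℕ → Prog
  | .const c, d => .assign (2 * d + 2) (.const c)
  | .var x, d => .assign (2 * d + 2) (.reg (2 * x + 1))
  | .entry a x y, d => .assign (2 * d + 2) (.get (slot a) (position x y))
  | .add e₁ e₂, d => .seq (e₁.code d) <| .seq (e₂.code (d + 1)) <|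
      .assign (2 * d + 2) (.add (.reg (2 * d + 2)) (.reg (2 * (d + 1) + 2)))
  | .sub e₁ e₂, d => .seq (e₁.code d) <| .seq (e₂.code (d + 1)) <|
      .assign (2 * d + 2) (.sub (.reg (2 * d + 2)) (.reg (2 * (d + 1) + 2)))
  | .ite c e₁ e₂, d => .seq (c.code d) <| .cond (.reg (2 * d + 2)) (e₁.code d) (e₂.code d)
  | .sum x e, d => .seq (.assign (2 * (d + 1) + 2) (.const 0)) <|
      .seq (.forVar (2 * x + 1) (2 * d + 2) <| .seq (e.code (d + 2)) <|
        .assign (2 * (d + 1) + 2) (.add (.reg (2 * (d + 1) + 2)) (.reg (2 * (d + 2) + 2)))) <|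
      .assign (2 * d + 2) (.reg (2 * (d + 1) + 2))

/-- A bound for the running time of the code of a term. -/
noncomputable def Term.time : Term → Polynomial ℕ
  | .const _ => 2
  | .var _ => 2
  | .entry _ _ _ => 6
  | .add e₁ e₂ => e₁.time + (e₂.time + 4)
  | .sub e₁ e₂ => e₁.time + (e₂.time + 4)
  | .ite c e₁ e₂ => c.time + (2 + (e₁.time + e₂.time))
  | .sum _ e => 2 + ((.X * ((e.time + 4) + 8) + 12) + 2)

/-- The machine code of a command. -/
def Cmd.code : Cmd → ℕ → Prog
  | .skip, _ => .skip
  | .assign a e, d => .seq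
      (.forVar (2 * 0 + 1) (2 * d + 2) <| .forVar (2 * 1 + 1) (2 * (d + 1) + 2) <|
        .seq (e.code (d + 2)) <| .store 3 (position 0 1) (.reg (2 * (d + 2) + 2)))
      (.forVar (2 * 0 + 1) (2 * d + 2) <| .forVar (2 * 1 + 1) (2 * (d + 1) + 2) <|
        .store (slot a) (position 0 1) (.get 3 (position 0 1)))
  | .seq S S', d => .seq (S.code d) (S'.code d)
  | .when c S, d => .seq (c.code d) <| .cond (.reg (2 * d + 2)) (S.code d) .skip
  | .each x S, d => .forVar (2 * x + 1) (2 * d + 2) (S.code (d + 1))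

/-- A bound for the running time of the code of a command. -/
noncomputable def Cmd.time : Cmd → Polynomial ℕ
  | .skip => 1
  | .assign _ e => (.X * ((.X * ((e.time + 6) + 8) + 12) + 8) + 12) +
      (.X * ((.X * (10 + 8) + 12) + 8) + 12)
  | .seq S S' => S.time + S'.time
  | .when c S => c.time + (2 + (S.time + 1))
  | .each _ S => .X * (S.time + 8) + 12

/-- The machine state `s` represents the store `σ` and the environment `ρ`. -/
structure Represents {n : ℕ} (s : State) (σ : Store n) (ρ : Env n) : Prop where
  size : s.reg 0 = n
  var : ∀ x, s.reg (2 * x + 1) = ρ x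
  mul : ∀ u : Fin n, s.arr 4 u = u * n
  mat : ∀ a (u v : Fin n), s.arr (slot a) (u * n + v) = σ a u v

theorem Represents.frame {n d : ℕ} {s s' : State} {σ : Store n} {ρ : Env n}
    (h : Represents s σ ρ) (hf : Frame d s s') (ha : s'.arr = s.arr) : Represents s' σ ρ where
  size := by rw [hf 0 (by omega), h.size]
  var x := by rw [hf _ (by omega), h.var]
  mul u := by rw [ha, h.mul]
  mat a u v := by rw [ha, h.mat]

theorem Represents.setVar {n : ℕ} {s : State} {σ : Store n} {ρ : Env n}
    (h : Represents s σ ρ) (x : ℕ) (i : Fin n) :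
    Represents (s.setReg (2 * x + 1) i) σ (Function.update ρ x i) where
  size := by rw [State.setReg_reg, if_neg (by omega), h.size]
  var y := by
    rw [State.setReg_reg, Function.update_apply]
    by_cases hxy : y = x
    · simp [hxy]
    · rw [if_neg (by omega), if_neg hxy, h.var]
  mul := h.mul
  mat := h.mat

theorem Represents.position {n : ℕ} {s : State} {σ : Store n} {ρ : Env n}
    (h : Represents s σ ρ) (x y : ℕ) :
    (MatrixProgram.position x y).eval s = ρ x * n + ρ y := by
  simp only [MatrixProgram.position, Expr.eval, h.var, h.mul]

theorem position_injective {n : ℕ} {u v u' v' : Fin n}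
    (h : (u * n + v : ℕ) = u' * n + v') : u = u' ∧ v = v' := by
  have hv : (v : ℕ) = v' := by
    have := congrArg (· % n) h
    simpa [Nat.mod_eq_of_lt v.2, Nat.mod_eq_of_lt v'.2] using this
  have hn : 0 < n := u.pos
  have hu : (u : ℕ) * n = u' * n := by omega
  exact ⟨Fin.ext (Nat.eq_of_mul_eq_mul_right hn hu), Fin.ext hv⟩

theorem Term.runs_code {n : ℕ} (e : Term) : ∀ (d : ℕ) (s : State) (σ : Store n) (ρ : Env n),
    Represents s σ ρ → (e.code d).Runs s (e.time.eval n)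
      fun s' => s'.arr = s.arr ∧ s'.reg (2 * d + 2) = e.val σ ρ ∧ Frame d s s' := by
  induction e with
  | const c =>
    intro d s σ ρ h
    exact Prog.runs_assign (by simp [Expr.cost, Term.time])
      ⟨rfl, by simp [State.setReg_reg, Expr.eval, Term.val], (Frame.refl d s).setReg le_rfl _⟩
  | var x =>
    intro d s σ ρ h
    exact Prog.runs_assign (by simp [Expr.cost, Term.time])
      ⟨rfl, by simp [State.setReg_reg, Expr.eval, Term.val, h.var],
        (Frame.refl d s).setReg le_rfl _⟩
  | entry a x y =>
    intro d s σ ρ h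
    refine Prog.runs_assign (by simp [Expr.cost, Term.time, position])
      ⟨rfl, ?_, (Frame.refl d s).setReg le_rfl _⟩
    rw [State.setReg_reg, if_pos rfl, Expr.eval, h.position, h.mat, Term.val]
  | add e₁ e₂ ih₁ ih₂ =>
    intro d s σ ρ h
    simp only [Term.time, Polynomial.eval_add]
    refine (ih₁ d s σ ρ h).seq fun s₁ ⟨ha₁, hv₁, hf₁⟩ =>
      (ih₂ (d + 1) s₁ σ ρ (h.frame hf₁ ha₁)).seq fun s₂ ⟨ha₂, hv₂, hf₂⟩ =>
      Prog.runs_assign (by simp [Expr.cost]) ⟨by simp [ha₁, ha₂], ?_,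
        (hf₁.trans (hf₂.mono (by omega))).setReg le_rfl _⟩
    rw [State.setReg_reg, if_pos rfl, Expr.eval, Expr.eval, Expr.eval, hv₂,
      hf₂ _ (by omega), hv₁, Term.val]
  | sub e₁ e₂ ih₁ ih₂ =>
    intro d s σ ρ h
    simp only [Term.time, Polynomial.eval_add]
    refine (ih₁ d s σ ρ h).seq fun s₁ ⟨ha₁, hv₁, hf₁⟩ =>
      (ih₂ (d + 1) s₁ σ ρ (h.frame hf₁ ha₁)).seq fun s₂ ⟨ha₂, hv₂, hf₂⟩ =>
      Prog.runs_assign (by simp [Expr.cost]) ⟨by simp [ha₁, ha₂], ?_,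
        (hf₁.trans (hf₂.mono (by omega))).setReg le_rfl _⟩
    rw [State.setReg_reg, if_pos rfl, Expr.eval, Expr.eval, Expr.eval, hv₂,
      hf₂ _ (by omega), hv₁, Term.val]
  | ite c e₁ e₂ ihc ih₁ ih₂ =>
    intro d s σ ρ h
    simp only [Term.time, Polynomial.eval_add]
    refine (ihc d s σ ρ h).seq fun s₁ ⟨ha₁, hv₁, hf₁⟩ =>
      (Prog.runs_cond (T := e₁.time.eval n + e₂.time.eval n) ?_ ?_).mono (by simp [Expr.cost])
        fun _ hs => hs
    · intro hc
      rw [Expr.eval, hv₁] at hc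
      refine (ih₁ d s₁ σ ρ (h.frame hf₁ ha₁)).mono (by omega) fun s₂ ⟨ha₂, hv₂, hf₂⟩ =>
        ⟨ha₂.trans ha₁, ?_, hf₁.trans hf₂⟩
      rw [hv₂, Term.val, if_pos hc]
    · intro hc
      rw [Expr.eval, hv₁] at hc
      refine (ih₂ d s₁ σ ρ (h.frame hf₁ ha₁)).mono (by omega) fun s₂ ⟨ha₂, hv₂, hf₂⟩ =>
        ⟨ha₂.trans ha₁, ?_, hf₁.trans hf₂⟩
      rw [hv₂, Term.val, if_neg (by simpa using hc)]
  | sum x e ih =>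
    intro d s σ ρ h
    simp only [Term.time, Polynomial.eval_add, Polynomial.eval_mul, Polynomial.eval_X]
    refine Prog.Runs.seq
      (Q := fun s₁ => s₁ = s.setReg (2 * (d + 1) + 2) 0)
      (Prog.runs_assign (by simp [Expr.cost]) rfl) ?_
    rintro _ rfl
    set s₀ := s.setReg (2 * (d + 1) + 2) 0 with hs₀
    have hf₀ : Frame d s s₀ := (Frame.refl d s).setReg (by omega) _
    have h₀ : Represents s₀ σ ρ := h.frame hf₀ rfl
    refine Prog.Runs.seq (Q := fun s₁ => Frame d s₀ s₁ ∧ s₁.arr = s.arr ∧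
      s₁.reg (2 * (d + 1) + 2) = (Term.sum x e).val σ ρ) ?_ ?_
    · refine (Prog.runs_forVar (n := n) (d := d) (e := d) (T := e.time.eval n + 4) le_rfl h₀.size
        (fun k s₁ => s₁.arr = s.arr ∧ s₁.reg (2 * (d + 1) + 2) =
          ∑ i ∈ Finset.univ.filter (fun i : Fin n => (i : ℕ) < k),
            e.val σ (Function.update ρ x i)) ?_ ?_ ?_).mono (by simp) ?_
      · rintro k s₁ r v hr ⟨ha, hv⟩
        refine ⟨ha, ?_⟩
        rw [State.setReg_reg, if_neg (by omega), hv]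
      · simp [hs₀, State.setReg_reg]
      · rintro k hk s₁ hf ⟨ha, hv⟩
        have hrep : Represents s₁ σ (Function.update ρ x ⟨k, hk⟩) :=
          (h₀.setVar x ⟨k, hk⟩).frame hf (by rw [ha]; rfl)
        refine (ih (d + 2) s₁ σ _ hrep).seq fun s₂ ⟨ha₂, hv₂, hf₂⟩ =>
          Prog.runs_assign (by simp [Expr.cost])
            ⟨(hf₂.mono (by omega)).setReg le_rfl _, ha₂.trans ha, ?_⟩
        rw [State.setReg_reg, if_pos rfl, Expr.eval, Expr.eval, Expr.eval, hv₂,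
          hf₂ _ (by omega), hv]
        have : Finset.univ.filter (fun i : Fin n => (i : ℕ) < k + 1) =
            insert ⟨k, hk⟩ (Finset.univ.filter (fun i : Fin n => (i : ℕ) < k)) := by
          ext i; simp [Fin.ext_iff]; omega
        rw [this, Finset.sum_insert (by simp), add_comm]
      · rintro s₁ ⟨hf, ha, hv⟩
        refine ⟨hf, ha, ?_⟩
        rw [hv, Term.val, Finset.filter_true_of_mem (fun i _ => i.2)]
    · rintro s₁ ⟨hf, ha, hv⟩
      exact Prog.runs_assign (by simp [Expr.cost]) ⟨ha, by
        rw [State.setReg_reg, if_pos rfl, Expr.eval, hv], (hf₀.trans hf).setReg le_rfl _⟩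

theorem foldl_finRange_prefix {n : ℕ} {α : Type*} (f : α → Fin n → α) (a : α) (k : ℕ)
    (hk : k < n) : ((List.finRange n).take (k + 1)).foldl f a =
      f (((List.finRange n).take k).foldl f a) ⟨k, hk⟩ := by
  rw [List.take_add_one, List.foldl_append]
  simp [hk]

/-- A double loop writing the values `g u v` into an array row by row. -/
theorem runs_fill {n d a T : ℕ} {P : Prog} {s : State}
    (g : Fin n → Fin n → ℕ) (hs : s.reg 0 = n)
    (hP : ∀ (u v : Fin n) (s₁ : State),
      Frame d ((s.setReg (2 * 0 + 1) u).setReg (2 * 1 + 1) v) s₁ →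
      (∀ c j, c ≠ a → s₁.arr c j = s.arr c j) →
      P.Runs s₁ T fun s₂ => Frame (d + 2) s₁ s₂ ∧
        ∀ c j, s₂.arr c j = if c = a ∧ j = u * n + v then g u v else s₁.arr c j) :
    (Prog.forVar (2 * 0 + 1) (2 * d + 2) <| Prog.forVar (2 * 1 + 1) (2 * (d + 1) + 2) P).Runs s
      (n * ((n * (T + 8) + 12) + 8) + 12)
      fun s' => Frame d s s' ∧ (∀ c j, c ≠ a → s'.arr c j = s.arr c j) ∧
        ∀ u v : Fin n, s'.arr a (u * n + v) = g u v := by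
  refine (Prog.runs_forVar (n := n) (d := d) (e := d) (T := n * (T + 8) + 12) le_rfl hs
    (fun k s₁ => (∀ c j, c ≠ a → s₁.arr c j = s.arr c j) ∧
      ∀ u v : Fin n, (u : ℕ) < k → s₁.arr a (u * n + v) = g u v) ?_ ?_ ?_).mono le_rfl ?_
  · rintro k s₁ r v - h; exact h
  · exact ⟨fun _ _ _ => rfl, fun u v h => absurd h (by omega)⟩
  · rintro k hk s₁ hf ⟨ho, hg⟩
    have hs₁ : s₁.reg 0 = n := by
      rw [hf 0 (by omega), State.setReg_reg, if_neg (by omega), hs]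
    refine (Prog.runs_forVar (n := n) (d := d + 1) (e := d + 1) (T := T) le_rfl hs₁
      (fun l s₂ => (∀ c j, c ≠ a → s₂.arr c j = s.arr c j) ∧
        ∀ u v : Fin n, (u : ℕ) < k ∨ (u : ℕ) = k ∧ (v : ℕ) < l →
          s₂.arr a (u * n + v) = g u v) ?_ ?_ ?_).mono le_rfl ?_
    · rintro l s₂ r v - h; exact h
    · exact ⟨ho, fun u v h => hg u v (by omega)⟩
    · rintro l hl s₂ hf₂ ⟨ho₂, hg₂⟩
      refine (hP ⟨k, hk⟩ ⟨l, hl⟩ s₂ ?_ ho₂).mono le_rfl ?_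
      · intro r hr
        rw [hf₂ r (by omega), State.setReg_reg, State.setReg_reg]
        split_ifs with h
        · rfl
        · exact hf r hr
      · rintro s₃ ⟨hf₃, ha₃⟩
        refine ⟨hf₃, fun c j hc => ?_, fun u v huv => ?_⟩
        · rw [ha₃, if_neg (by tauto), ho₂ c j hc]
        · rw [ha₃]
          split_ifs with h
          · obtain ⟨h1, h2⟩ := position_injective h.2
            rw [h1, h2]
          · apply hg₂
            by_contra hcon
            apply h
            have h1 : (u : ℕ) = k := by omega
            have h2 : (v : ℕ) = l := by omega
            simp [h1, h2]
    · rintro s₂ ⟨hf₂, ho₂, hg₂⟩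
      exact ⟨hf₂, ho₂, fun u v huv => hg₂ u v (by have := v.2; omega)⟩
  · rintro s' ⟨hf, ho, hg⟩
    exact ⟨hf, ho, fun u v => hg u v u.2⟩

theorem Represents.of_arr {n d : ℕ} {s s' : State} {σ : Store n} {ρ : Env n}
    (h : Represents s σ ρ) (hf : Frame d s s') (ha : ∀ c j, c ≠ 3 → s'.arr c j = s.arr c j) :
    Represents s' σ ρ where
  size := by rw [hf 0 (by omega), h.size]
  var x := by rw [hf _ (by omega), h.var]
  mul u := by rw [ha _ _ (by omega), h.mul]
  mat a u v := by rw [ha _ _ (slot_ne_three a), h.mat]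

/-- The code of a command computes its effect on the store, in polynomial time. -/
theorem Cmd.runs_code {n : ℕ} (S : Cmd) : ∀ (d : ℕ) (s : State) (σ : Store n) (ρ : Env n),
    Represents s σ ρ → (S.code d).Runs s (S.time.eval n)
      fun s' => Represents s' (S.run ρ σ) ρ ∧ Frame d s s' := by
  induction S with
  | skip =>
    intro d s σ ρ h
    exact ⟨1, s, .skip s, by simp [Cmd.time], h, Frame.refl d s⟩
  | assign a e =>
    intro d s σ ρ h
    simp only [Cmd.time, Polynomial.eval_add, Polynomial.eval_mul, Polynomial.eval_X]
    set g : Fin n → Fin n → ℕ :=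
      fun u v => e.val σ (Function.update (Function.update ρ 0 u) 1 v) with hg
    refine Prog.Runs.seq (Q := fun s' => Frame d s s' ∧
      (∀ c j, c ≠ 3 → s'.arr c j = s.arr c j) ∧ ∀ u v : Fin n, s'.arr 3 (u * n + v) = g u v) ?_ ?_
    · refine (runs_fill (d := d) (a := 3) (T := e.time.eval n + 6) g h.size ?_).mono
        (by simp) fun _ hs => hs
      intro u v s₁ hf ha
      have hrep : Represents s₁ σ (Function.update (Function.update ρ 0 u) 1 v) :=
        ((h.setVar 0 u).setVar 1 v).of_arr hf ha
      refine (Term.runs_code e (d + 2) s₁ σ _ hrep).seq fun s₂ ⟨ha₂, hv₂, hf₂⟩ =>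
        Prog.runs_store (by simp [Expr.cost, position]) ⟨hf₂, ?_⟩
      intro c j
      rw [State.setArr_arr, (hrep.frame hf₂ ha₂).position, Expr.eval, hv₂, ha₂]
      simp [hg]
    · rintro s₁ ⟨hf₁, ho₁, hg₁⟩
      have h₁ := h.of_arr hf₁ ho₁
      refine (runs_fill (d := d) (a := slot a) (T := 10) g h₁.size ?_).mono
        (by simp) ?_
      · intro u v s₂ hf ha
        have hf' : Frame d ((s₁.setReg (2 * 0 + 1) u).setReg (2 * 1 + 1) v) s₂ := hf
        have hpos : (position 0 1).eval s₂ = u * n + v := by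
          have hr : ∀ x, s₂.reg (2 * x + 1) =
              Function.update (Function.update ρ 0 u) 1 v x := fun x => by
            rw [hf' _ (by omega)]; exact ((h₁.setVar 0 u).setVar 1 v).var x
          simp only [position, Expr.eval, hr, ha 4 _ (slot_ne_four a).symm, h₁.mul]
          simp
        refine Prog.runs_store (by simp [Expr.cost, position]) ⟨Frame.refl _ _, fun c j => ?_⟩
        rw [State.setArr_arr, Expr.eval, hpos, ha 3 _ (slot_ne_three a).symm, hg₁]
      · rintro s₂ ⟨hf₂, ho₂, hg₂⟩
        refine ⟨⟨?_, ?_, ?_, ?_⟩, hf₁.trans hf₂⟩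
        · rw [hf₂ 0 (by omega), h₁.size]
        · intro x; rw [hf₂ _ (by omega), h₁.var]
        · intro u; rw [ho₂ _ _ (slot_ne_four a).symm, h₁.mul]
        · intro b u v
          by_cases hb : b = a
          · subst hb; rw [hg₂]; simp [Cmd.run, hg]
          · rw [ho₂ _ _ (fun hc => hb (slot_injective hc)), h₁.mat]
            simp [Cmd.run, hb]
  | seq S S' ih ih' =>
    intro d s σ ρ h
    simp only [Cmd.time, Polynomial.eval_add]
    exact (ih d s σ ρ h).seq fun s₁ ⟨h₁, hf₁⟩ =>
      (ih' d s₁ _ ρ h₁).mono le_rfl fun s₂ ⟨h₂, hf₂⟩ => ⟨h₂, hf₁.trans hf₂⟩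
  | when c S ih =>
    intro d s σ ρ h
    simp only [Cmd.time, Polynomial.eval_add]
    refine (Term.runs_code c d s σ ρ h).seq fun s₁ ⟨ha₁, hv₁, hf₁⟩ =>
      (Prog.runs_cond (T := S.time.eval n + 1) ?_ ?_).mono (by simp [Expr.cost])
        fun _ hs => hs
    · intro hc
      rw [Expr.eval, hv₁] at hc
      refine (ih d s₁ σ ρ (h.frame hf₁ ha₁)).mono (by omega) fun s₂ ⟨h₂, hf₂⟩ =>
        ⟨?_, hf₁.trans hf₂⟩
      rwa [Cmd.run, if_pos hc]
    · intro hc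
      rw [Expr.eval, hv₁] at hc
      refine ⟨1, s₁, .skip s₁, by omega, ?_, hf₁⟩
      rw [Cmd.run, if_neg (by simpa using hc)]
      exact h.frame hf₁ ha₁
  | each x S ih =>
    intro d s σ ρ h
    simp only [Cmd.time, Polynomial.eval_add, Polynomial.eval_mul, Polynomial.eval_X]
    refine (Prog.runs_forVar (n := n) (d := d) (e := d) (T := S.time.eval n) le_rfl h.size
      (fun k s₁ => (∀ u : Fin n, s₁.arr 4 u = u * n) ∧ ∀ a (u v : Fin n),
        s₁.arr (slot a) (u * n + v) = (((List.finRange n).take k).foldl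
          (fun σ i => S.run (Function.update ρ x i) σ) σ) a u v) ?_ ?_ ?_).mono (by simp) ?_
    · rintro k s₁ r v - hs₁
      exact hs₁
    · exact ⟨h.mul, h.mat⟩
    · rintro k hk s₁ hf ⟨hmul, hmat⟩
      have hrep : Represents s₁ (((List.finRange n).take k).foldl
          (fun σ i => S.run (Function.update ρ x i) σ) σ) (Function.update ρ x ⟨k, hk⟩) :=
        { size := by rw [hf 0 (by omega)]; exact (h.setVar x ⟨k, hk⟩).size
          var := fun y => by rw [hf _ (by omega)]; exact (h.setVar x ⟨k, hk⟩).var y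
          mul := hmul
          mat := hmat }
      refine (ih (d + 1) s₁ _ _ hrep).mono le_rfl fun s₂ ⟨h₂, hf₂⟩ => ⟨hf₂, h₂.mul, ?_⟩
      rw [foldl_finRange_prefix _ _ k hk]
      exact h₂.mat
    · rintro s₁ ⟨hf, hmul, hmat⟩
      rw [List.take_of_length_le (by simp)] at hmat
      exact ⟨⟨by rw [hf 0 (by omega), h.size], fun y => by rw [hf _ (by omega), h.var], hmul, hmat⟩,
        hf⟩

end MatrixProgram

/-! ### Arborescences -/

namespace SteinerForest

/-- There is a directed path from `u` to `v` in the edge set `X`. -/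
abbrev Reaches {V : Type*} (X : Finset (V × V)) (u v : V) : Prop :=
  Relation.ReflTransGen (fun u v => (u, v) ∈ X) u v

theorem Reaches.mono {V : Type*} {X X' : Finset (V × V)} (h : X ⊆ X') {u v : V}
    (hr : Reaches X u v) : Reaches X' u v :=
  Relation.ReflTransGen.mono (fun _ _ hx => h hx) _ _ hr

/-- There is a walk with `k` edges from `u` to `v`. -/
inductive Walk {V : Type*} (E : V → V → Prop) : ℕ → V → V → Prop
  | nil (u : V) : Walk E 0 u u
  | cons {k : ℕ} {u v w : V} : E u v → Walk E k v w → Walk E (k + 1) u w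

theorem Walk.append {V : Type*} {E : V → V → Prop} {k l : ℕ} {u v w : V} (h : Walk E k u v)
    (h' : Walk E l v w) : Walk E (k + l) u w := by
  induction h with
  | nil => simpa using h'
  | cons he _ ih =>
    rw [show ∀ k : ℕ, k + 1 + l = k + l + 1 from fun k => by omega]
    exact .cons he (ih h')

/-- A distance function of the digraph `E`, as far as upper bounds are concerned. -/
structure IsDistance {V : Type*} (E : V → V → Prop) (d : V → V → ℕ) : Prop where
  self : ∀ u, d u u = 0
  le_add : ∀ u v w, E u v → d u w ≤ d v w + 1

theorem IsDistance.le_of_walk {V : Type*} {E : V → V → Prop} {d : V → V → ℕ}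
    (hd : IsDistance E d) {k : ℕ} {u v : V} (h : Walk E k u v) : d u v ≤ k := by
  induction h with
  | nil u => rw [hd.self]
  | cons he _ ih => exact (hd.le_add _ _ _ he).trans (by omega)

variable {V : Type*} [DecidableEq V]

/-- `Arborescence E r c Y`: an out-tree of the digraph `E` with root `r` and `c` edges contains all
vertices of `Y`.  The tree is given by the way it is put together, and its branches may overlap:
only the number of edges and the covered vertices matter. -/
inductive Arborescence (E : V → V → Prop) : V → ℕ → Finset V → Prop
  | empty (r : V) : Arborescence E r 0 ∅
  | single (r : V) : Arborescence E r 0 {r}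
  | edge {r u : V} {c : ℕ} {Y : Finset V} :
      E r u → Arborescence E u c Y → Arborescence E r (c + 1) Y
  | join {r : V} {c c' : ℕ} {Y Y' : Finset V} :
      Arborescence E r c Y → Arborescence E r c' Y' → Arborescence E r (c + c') (Y ∪ Y')

/-- An edge can be attached to any vertex of an arborescence. -/
theorem Arborescence.graft {E : V → V → Prop} {r a b : V} {c : ℕ} {Y : Finset V}
    (h : Arborescence E r c Y) (ha : a ∈ Y) (hab : E a b) :
    Arborescence E r (c + 1) (insert b Y) := by
  induction h with
  | empty r => simp at ha
  | single r =>
    obtain rfl : a = r := by simpa using ha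
    have := Arborescence.join (.single a) (.edge hab (.single b))
    rwa [Finset.union_comm] at this
  | edge h _ ih => exact .edge h (ih ha)
  | @join r c c' Y Y' h h' ih ih' =>
    rcases Finset.mem_union.1 ha with ha | ha
    · have := (ih ha).join h'
      rwa [show c + 1 + c' = c + c' + 1 by ring, Finset.insert_union] at this
    · have := h.join (ih' ha)
      rwa [← add_assoc, Finset.union_insert] at this

theorem Arborescence.subset_singleton {E : V → V → Prop} {r : V} {c : ℕ} {Y : Finset V}
    (h : Arborescence E r c Y) (hc : c = 0) : Y ⊆ {r} := by
  induction h with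
  | empty r => simp
  | single r => simp
  | edge h _ ih => omega
  | join h h' ih ih' => exact Finset.union_subset (ih (by omega)) (ih' (by omega))

/-- The vertices reachable from `r` in a finite edge set are spanned by an arborescence. -/
theorem exists_arborescence [Fintype V] {E : V → V → Prop} (F : Finset (V × V))
    (hF : ∀ e ∈ F, E e.1 e.2) (r : V) :
    ∃ c Y, Arborescence E r c Y ∧ c ≤ F.card ∧ c < Fintype.card V ∧
      ∀ t, Relation.ReflTransGen (fun u v => (u, v) ∈ F) r t → t ∈ Y := by
  classical
  set P : Finset V → Prop := fun Y =>
    r ∈ Y ∧ Y.erase r ⊆ F.image Prod.snd ∧ Arborescence E r (Y.erase r).card Y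
  obtain ⟨Y, hY, hmax⟩ := (Finset.univ.filter P).exists_max_image Finset.card
    ⟨{r}, by simpa [P] using Arborescence.single r⟩
  obtain ⟨hr, himg, hA⟩ := (Finset.mem_filter.1 hY).2
  refine ⟨_, Y, hA, (Finset.card_le_card himg).trans Finset.card_image_le, ?_, fun t ht => ?_⟩
  · exact (Finset.card_erase_lt_of_mem hr).trans_le (Finset.card_le_univ Y)
  · induction ht with
    | refl => exact hr
    | @tail a b _ hab ih =>
      by_contra hb
      have hbr : b ≠ r := fun h => hb (h ▸ hr)
      have hcard : ((insert b Y).erase r).card = (Y.erase r).card + 1 := by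
        rw [Finset.erase_insert_of_ne hbr, Finset.card_insert_of_notMem]
        simp [hb]
      have hins : P (insert b Y) := by
        refine ⟨by simp [hr], ?_, ?_⟩
        · rw [Finset.erase_insert_of_ne hbr]
          exact Finset.insert_subset (Finset.mem_image.2 ⟨_, hab, rfl⟩) himg
        · rw [hcard]; exact hA.graft ih (hF _ hab)
      have := hmax _ (Finset.mem_filter.2 ⟨Finset.mem_univ _, hins⟩)
      rw [Finset.card_insert_of_notMem hb] at this
      omega

/-- An arborescence with `c` edges splits into a remainder with fewer than `s` edges and `j`
pieces with at least `s` and fewer than `2 * s` edges: the edges are collected from the leaves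
towards the root, and a piece is cut off as soon as it is large enough.  Here the pieces are only
used through a bound `g` for the number of elements of `U` in a piece. -/
theorem Arborescence.split {E : V → V → Prop} {d : V → V → ℕ} (hd : IsDistance E d) {s g : ℕ}
    (hs : 1 ≤ s) (U : Finset V) {r : V} {c : ℕ} {Y : Finset V} (h : Arborescence E r c Y)
    (hg : ∀ u c' Y', d r u ≤ c → c' ≤ c → c' < 2 * s → Arborescence E u c' Y' →
      (Y' ∩ U).card ≤ g) :
    ∃ c₀ Y₀ W j, c₀ < s ∧ Arborescence E r c₀ Y₀ ∧ j * s + c₀ ≤ c ∧ Y ⊆ Y₀ ∪ W ∧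
      (W ∩ U).card ≤ j * g := by
  induction h with
  | empty r => exact ⟨0, ∅, ∅, 0, by omega, .empty r, by simp, by simp, by simp⟩
  | single r => exact ⟨0, {r}, ∅, 0, by omega, .single r, by simp, by simp, by simp⟩
  | @edge r u c Y hru _ ih =>
    obtain ⟨c₀, Y₀, W, j, hc₀, hA, hj, hY, hW⟩ := ih fun x c' Y' hx hc' =>
      hg x c' Y' ((hd.le_add _ _ _ hru).trans (by omega)) (by omega)
    by_cases h : c₀ + 1 < s
    · exact ⟨c₀ + 1, Y₀, W, j, h, .edge hru hA, by omega, hY, hW⟩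
    · have := hg r (c₀ + 1) Y₀ (by simp [hd.self]) (by omega) (by omega) (.edge hru hA)
      refine ⟨0, ∅, Y₀ ∪ W, j + 1, by omega, .empty r, ?_, by simpa using hY, ?_⟩
      · rw [add_mul]; omega
      · rw [add_mul, Finset.union_inter_distrib_right]
        exact (Finset.card_union_le _ _).trans (by omega)
  | @join r c₁ c₂ Y₁ Y₂ _ _ ih₁ ih₂ =>
    obtain ⟨a₁, Z₁, W₁, j₁, ha₁, hA₁, hj₁, hY₁, hW₁⟩ := ih₁ fun x c' Y' hx hc' =>
      hg x c' Y' (by omega) (by omega)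
    obtain ⟨a₂, Z₂, W₂, j₂, ha₂, hA₂, hj₂, hY₂, hW₂⟩ := ih₂ fun x c' Y' hx hc' =>
      hg x c' Y' (by omega) (by omega)
    have hW : ((W₁ ∪ W₂) ∩ U).card ≤ (j₁ + j₂) * g := by
      rw [add_mul, Finset.union_inter_distrib_right]
      exact (Finset.card_union_le _ _).trans (by omega)
    have hY : Y₁ ∪ Y₂ ⊆ (Z₁ ∪ Z₂) ∪ (W₁ ∪ W₂) := by
      rw [Finset.union_union_union_comm]
      exact Finset.union_subset_union hY₁ hY₂
    by_cases h : a₁ + a₂ < s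
    · exact ⟨a₁ + a₂, Z₁ ∪ Z₂, W₁ ∪ W₂, j₁ + j₂, h, hA₁.join hA₂, by rw [add_mul]; omega, hY, hW⟩
    · have := hg r (a₁ + a₂) _ (by simp [hd.self]) (by rw [add_comm]; omega) (by omega)
        (hA₁.join hA₂)
      refine ⟨0, ∅, (Z₁ ∪ Z₂) ∪ (W₁ ∪ W₂), j₁ + j₂ + 1, by omega, .empty r, ?_,
        by simpa using hY, ?_⟩
      · rw [add_mul, add_mul]; omega
      · rw [add_mul _ 1, Finset.union_inter_distrib_right]
        exact (Finset.card_union_le _ _).trans (by omega)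

theorem Arborescence.card_inter_le {E : V → V → Prop} {d : V → V → ℕ} (hd : IsDistance E d)
    {g : ℕ} (U : Finset V) {r : V} {c : ℕ} {Y : Finset V} (h : Arborescence E r c Y)
    (hg : ∀ u, d r u ≤ c → (({u} : Finset V) ∩ U).card ≤ g) :
    ∃ W : Finset V, Y ⊆ {r} ∪ W ∧ (W ∩ U).card ≤ c * g := by
  induction h with
  | empty r => exact ⟨∅, by simp, by simp⟩
  | single r => exact ⟨∅, by simp, by simp⟩
  | @edge r u c Y hru _ ih =>
    obtain ⟨W, hY, hW⟩ := ih fun x hx => hg x ((hd.le_add _ _ _ hru).trans (by omega))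
    refine ⟨{u} ∪ W, hY.trans Finset.subset_union_right, ?_⟩
    have := hg u ((hd.le_add _ _ _ hru).trans (by rw [hd.self]; omega))
    rw [add_mul, Finset.union_inter_distrib_right]
    exact (Finset.card_union_le _ _).trans (by omega)
  | @join r c₁ c₂ Y₁ Y₂ _ _ ih₁ ih₂ =>
    obtain ⟨W₁, hY₁, hW₁⟩ := ih₁ fun x hx => hg x (by omega)
    obtain ⟨W₂, hY₂, hW₂⟩ := ih₂ fun x hx => hg x (by omega)
    refine ⟨W₁ ∪ W₂, ?_, ?_⟩
    · rw [Finset.union_union_distrib_left]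
      exact Finset.union_subset_union hY₁ hY₂
    · rw [add_mul, Finset.union_inter_distrib_right]
      exact (Finset.card_union_le _ _).trans (by omega)

/-- Every arborescence with at most `a` edges consists of `q + 1` pieces with at most `b` edges
each, whose roots have distance at most `a` from its root.  As before, pieces are used through a
bound `g` for the number of elements of a set `U` in a piece. -/
def Splits (E : V → V → Prop) (d : V → V → ℕ) (q a b : ℕ) : Prop :=
  ∀ (r : V) (c : ℕ) (Y U : Finset V) (g : ℕ), c ≤ a → Arborescence E r c Y →
    (∀ u c' Y', d r u ≤ a → c' ≤ b → Arborescence E u c' Y' → (Y' ∩ U).card ≤ g) →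
    (Y ∩ U).card ≤ (q + 1) * g

/-- Apart from the bound `N`, this says that an arborescence with at most `q * s` edges splits into
pieces with at most `2 * s` edges; no piece has more edges than the arborescence. -/
theorem splits_min {E : V → V → Prop} {d : V → V → ℕ} (hd : IsDistance E d) {q s : ℕ} (N : ℕ)
    (hs : 1 ≤ s) : Splits E d q (min (q * s) N) (min (2 * s) N) := by
  intro r c Y U g hc hA hg
  obtain ⟨c₀, Y₀, W, j, hc₀, hA₀, hj, hY, hW⟩ := hA.split hd hs U fun u c' Y' hu hc' hs' hA' =>
    hg u c' Y' (by omega) (by omega) hA'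
  have hj' : j ≤ q := by
    by_contra hlt
    have : (q + 1) * s ≤ j * s := Nat.mul_le_mul_right _ (by omega)
    rw [add_mul] at this
    omega
  have h0 := hg r c₀ Y₀ (by simp [hd.self]) (by
    have : c₀ ≤ c := by omega
    omega) hA₀
  have hjg : j * g ≤ q * g := Nat.mul_le_mul_right _ hj'
  calc (Y ∩ U).card ≤ ((Y₀ ∪ W) ∩ U).card :=
        Finset.card_le_card (Finset.inter_subset_inter_right hY)
    _ ≤ (Y₀ ∩ U).card + (W ∩ U).card := by
        rw [Finset.union_inter_distrib_right]; exact Finset.card_union_le _ _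
    _ ≤ (q + 1) * g := by rw [add_mul]; omega

/-- An arborescence with at most `q` edges splits into its at most `q + 1` vertices. -/
theorem splits_zero {E : V → V → Prop} {d : V → V → ℕ} (hd : IsDistance E d) {q a : ℕ}
    (ha : a ≤ q) : Splits E d q a 0 := by
  intro r c Y U g hc hA hg
  obtain ⟨W, hY, hW⟩ := hA.card_inter_le hd (g := g) U fun u hu =>
    hg u 0 {u} (by omega) le_rfl (.single u)
  have h0 := hg r 0 {r} (by simp [hd.self]) le_rfl (.single r)
  have hjg : c * g ≤ q * g := Nat.mul_le_mul_right _ (by omega)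
  calc (Y ∩ U).card ≤ (({r} ∪ W) ∩ U).card :=
        Finset.card_le_card (Finset.inter_subset_inter_right hY)
    _ ≤ (({r} : Finset V) ∩ U).card + (W ∩ U).card := by
        rw [Finset.union_inter_distrib_right]; exact Finset.card_union_le _ _
    _ ≤ (q + 1) * g := by rw [add_mul]; omega

/-! ### The recursive greedy algorithm -/

theorem card_inter_add_card_le {Y A A' : Finset V} (h : A' ⊆ A) :
    (Y ∩ A).card + A'.card ≤ (Y ∩ A').card + A.card := by
  have h1 := Finset.card_sdiff_add_card_eq_card h
  have h2 : (Y ∩ A).card ≤ (Y ∩ A').card + (A \ A').card := by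
    refine (Finset.card_le_card ?_).trans (Finset.card_union_le _ _)
    intro x hx
    simp only [Finset.mem_union, Finset.mem_inter, Finset.mem_sdiff] at hx ⊢
    tauto
  omega

variable [Fintype V]

open Classical in
/-- The targets of the source `s` which the edge set `X` does not reach. -/
noncomputable def unsatisfied (T : Finset (V × V)) (s : V) (X : Finset (V × V)) : Finset V :=
  Finset.univ.filter fun t => (s, t) ∈ T ∧ ¬ Reaches X s t

theorem mem_unsatisfied {T : Finset (V × V)} {s t : V} {X : Finset (V × V)} :
    t ∈ unsatisfied T s X ↔ (s, t) ∈ T ∧ ¬ Reaches X s t := by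
  simp [unsatisfied]

theorem unsatisfied_anti {T : Finset (V × V)} {s : V} {X X' : Finset (V × V)} (h : X ⊆ X') :
    unsatisfied T s X' ⊆ unsatisfied T s X := fun t ht => by
  rw [mem_unsatisfied] at ht ⊢
  exact ⟨ht.1, fun hr => ht.2 (hr.mono h)⟩

/-- The cost of `k` levels of the greedy algorithm: each level makes `R` steps, and a step of
level `k + 1` buys a path with at most `cap (k + 1)` edges and the result of level `k`. -/
def cost (R : ℕ) (cap : ℕ → ℕ) : ℕ → ℕ
  | 0 => 0
  | k + 1 => R * (cap (k + 1) + cost R cap k)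

/-- `X'` is a possible result of `k` levels of the greedy algorithm for the source `s`, started at
the root `v` with the edges `X` already bought: it satisfies at least as many targets as any
arborescence with root `v` and at most `cap k` edges would.  (`H` is the condition on the
parameters under which this is claimed.) -/
structure Improves (H : Prop) (E : V → V → Prop) (T : Finset (V × V)) (s : V) (R : ℕ)
    (cap : ℕ → ℕ) (k : ℕ) (v : V) (X X' : Finset (V × V)) : Prop where
  subset : X ⊆ X'
  edges : ∀ e ∈ X', e ∈ X ∨ E e.1 e.2
  card_le : X'.card ≤ X.card + cost R cap k
  eq_of_empty : unsatisfied T s X = ∅ → X' = X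
  gain : H → Reaches X s v → ∀ c Y, c ≤ cap k → Arborescence E v c Y →
    (Y ∩ unsatisfied T s X).card + (unsatisfied T s X').card ≤ (unsatisfied T s X).card

theorem Improves.refl {H : Prop} {E : V → V → Prop} {T : Finset (V × V)} {s : V} {R : ℕ}
    {cap : ℕ → ℕ} (hcap : cap 0 = 0) (v : V) (X : Finset (V × V)) :
    Improves H E T s R cap 0 v X X where
  subset := subset_rfl
  edges _ he := Or.inl he
  card_le := by simp [cost]
  eq_of_empty _ := rfl
  gain _ hr c Y hc hA := by
    have : Y ∩ unsatisfied T s X = ∅ := by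
      ext t
      simp only [Finset.mem_inter, mem_unsatisfied, Finset.notMem_empty, iff_false]
      rintro ⟨ht, -, hn⟩
      have := hA.subset_singleton (by omega) ht
      rw [Finset.mem_singleton] at this
      exact hn (this ▸ hr)
    simp [this]

/-- `B` is the best result of one step of level `k + 1` of the greedy algorithm when the vertices
`u ∈ S` have been tried. -/
structure BestStep (H : Prop) (E : V → V → Prop) (d : V → V → ℕ) (T : Finset (V × V)) (s : V)
    (R : ℕ) (cap : ℕ → ℕ) (k : ℕ) (v : V) (S : Set V) (X B : Finset (V × V)) : Prop where
  subset : X ⊆ B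
  edges : ∀ e ∈ B, e ∈ X ∨ E e.1 e.2
  card_le : B.card ≤ X.card + (cap (k + 1) + cost R cap k)
  eq_of_empty : unsatisfied T s X = ∅ → B = X
  gain : H → Reaches X s v → ∀ u ∈ S, d v u ≤ cap (k + 1) → ∀ c Y, c ≤ cap k →
    Arborescence E u c Y →
    (Y ∩ unsatisfied T s X).card + (unsatisfied T s B).card ≤ (unsatisfied T s X).card

section Step

variable {H : Prop} {E : V → V → Prop} {d : V → V → ℕ} {T : Finset (V × V)} {s : V}
  {R : ℕ} {cap : ℕ → ℕ} {k : ℕ} {u v : V} {S : Set V} {X X₁ X₂ B : Finset (V × V)}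

theorem BestStep.refl : BestStep H E d T s R cap k v ∅ X X where
  subset := subset_rfl
  edges _ he := Or.inl he
  card_le := by simp
  eq_of_empty _ := rfl
  gain _ _ u hu := by simp at hu

theorem BestStep.skip (h : BestStep H E d T s R cap k v S X B) (hu : cap (k + 1) < d v u) :
    BestStep H E d T s R cap k v (insert u S) X B where
  __ := h
  gain hH hr w hw hd := by
    rcases hw with rfl | hw
    · omega
    · exact h.gain hH hr w hw hd

/-- `X₁` arises from `X` by adding a path from `v` to `u` with at most `a` edges. -/
structure AddsPath (E : V → V → Prop) (a : ℕ) (v u : V) (X X₁ : Finset (V × V)) : Prop where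
  subset : X ⊆ X₁
  edges : ∀ e ∈ X₁, e ∈ X ∨ E e.1 e.2
  card_le : X₁.card ≤ X.card + a
  reaches : Reaches X₁ v u

theorem AddsPath.gain (hp : AddsPath E (cap (k + 1)) v u X X₁)
    (hi : Improves H E T s R cap k u X₁ X₂) (hH : H) (hr : Reaches X s v) {c : ℕ} {Y : Finset V}
    (hc : c ≤ cap k) (hA : Arborescence E u c Y) :
    (Y ∩ unsatisfied T s X).card + (unsatisfied T s X₂).card ≤ (unsatisfied T s X).card := by
  have h1 := hi.gain hH ((hr.mono hp.subset).trans hp.reaches) c Y hc hA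
  have h2 := card_inter_add_card_le (Y := Y) (unsatisfied_anti (T := T) (s := s) hp.subset)
  omega

theorem BestStep.keep (h : BestStep H E d T s R cap k v S X B)
    (hp : AddsPath E (cap (k + 1)) v u X X₁) (hi : Improves H E T s R cap k u X₁ X₂)
    (hle : (unsatisfied T s B).card ≤ (unsatisfied T s X₂).card) :
    BestStep H E d T s R cap k v (insert u S) X B where
  __ := h
  gain hH hr w hw hd c Y hc hA := by
    rcases hw with rfl | hw
    · have := hp.gain hi hH hr hc hA
      omega
    · exact h.gain hH hr w hw hd c Y hc hA

theorem BestStep.take (h : BestStep H E d T s R cap k v S X B)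
    (hp : AddsPath E (cap (k + 1)) v u X X₁) (hi : Improves H E T s R cap k u X₁ X₂)
    (hlt : (unsatisfied T s X₂).card < (unsatisfied T s B).card) :
    BestStep H E d T s R cap k v (insert u S) X X₂ where
  subset := hp.subset.trans hi.subset
  edges e he := (hi.edges e he).elim (hp.edges e) Or.inr
  card_le := by have := hi.card_le; have := hp.card_le; omega
  eq_of_empty h0 := by
    rw [h.eq_of_empty h0, h0] at hlt
    simp at hlt
  gain hH hr w hw hd c Y hc hA := by
    rcases hw with rfl | hw
    · exact hp.gain hi hH hr hc hA
    · have := h.gain hH hr w hw hd c Y hc hA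
      omega

/-- `X'` is a possible result of `r` steps of level `k + 1`.  If an arborescence with at most
`cap (k + 1)` edges would satisfy `a` targets, then the number of targets satisfied so far falls
short of `a` by at most `(q / (q + 1)) ^ r * a`. -/
structure Steps (H : Prop) (E : V → V → Prop) (T : Finset (V × V)) (s : V) (R : ℕ)
    (cap : ℕ → ℕ) (q k : ℕ) (v : V) (r : ℕ) (X X' : Finset (V × V)) : Prop where
  subset : X ⊆ X'
  edges : ∀ e ∈ X', e ∈ X ∨ E e.1 e.2
  card_le : X'.card ≤ X.card + r * (cap (k + 1) + cost R cap k)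
  eq_of_empty : unsatisfied T s X = ∅ → X' = X
  gain : H → Reaches X s v → ∀ c Y, c ≤ cap (k + 1) → Arborescence E v c Y →
    ((q : ℤ) + 1) ^ r * ((Y ∩ unsatisfied T s X).card + (unsatisfied T s X').card -
      (unsatisfied T s X).card) ≤ (q : ℤ) ^ r * (Y ∩ unsatisfied T s X).card

theorem Steps.refl {q : ℕ} : Steps H E T s R cap q k v 0 X X where
  subset := subset_rfl
  edges _ he := Or.inl he
  card_le := by simp
  eq_of_empty _ := rfl
  gain _ _ c Y _ _ := by simp

/-- One of the `q + 1` pieces of an arborescence contains a `1 / (q + 1)` fraction of the targets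
that are still missing, and the best step gains at least as much as that piece. -/
theorem Steps.succ {q r : ℕ} (h : Steps H E T s R cap q k v r X X₁)
    (hsplit : H → Splits E d q (cap (k + 1)) (cap k))
    (hb : BestStep H E d T s R cap k v Set.univ X₁ B) :
    Steps H E T s R cap q k v (r + 1) X B where
  subset := h.subset.trans hb.subset
  edges e he := (hb.edges e he).elim (h.edges e) Or.inr
  card_le := by
    have := hb.card_le; have := h.card_le
    rw [add_mul]; omega
  eq_of_empty h0 := by
    have h1 := h.eq_of_empty h0
    rw [← h1] at h0 ⊢
    exact hb.eq_of_empty h0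
  gain hH hr c Y hc hA := by
    have h1 := h.gain hH hr c Y hc hA
    have hr₁ : Reaches X₁ s v := hr.mono h.subset
    have hsub := Finset.card_le_card (unsatisfied_anti (T := T) (s := s) hb.subset)
    have h2 := hsplit hH v c Y (unsatisfied T s X₁)
      ((unsatisfied T s X₁).card - (unsatisfied T s B).card) hc hA fun u c' Y' hu hc' hA' => by
        have := hb.gain hH hr₁ u (Set.mem_univ u) hu c' Y' hc' hA'
        omega
    have h3 := card_inter_add_card_le (Y := Y) (unsatisfied_anti (T := T) (s := s) h.subset)
    zify [hsub] at h2 h3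
    set x : ℤ := ((unsatisfied T s X).card : ℤ)
    set x₁ : ℤ := ((unsatisfied T s X₁).card : ℤ)
    set b : ℤ := ((unsatisfied T s B).card : ℤ)
    set a : ℤ := ((Y ∩ unsatisfied T s X).card : ℤ)
    have hb0 : b ≤ x₁ := Nat.cast_le.2 hsub
    have ha : 0 ≤ a := by positivity
    rcases le_or_gt (a + b - x) 0 with hneg | hpos
    · exact (mul_nonpos_of_nonneg_of_nonpos (by positivity) hneg).trans (by positivity)
    · have h4 : ((q : ℤ) + 1) * (a + b - x) ≤ q * (a + x₁ - x) := by linarith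
      calc ((q : ℤ) + 1) ^ (r + 1) * (a + b - x)
          = ((q : ℤ) + 1) ^ r * (((q : ℤ) + 1) * (a + b - x)) := by ring
        _ ≤ ((q : ℤ) + 1) ^ r * (q * (a + x₁ - x)) := by gcongr
        _ = q * (((q : ℤ) + 1) ^ r * (a + x₁ - x)) := by ring
        _ ≤ q * ((q : ℤ) ^ r * a) := by gcongr
        _ = (q : ℤ) ^ (r + 1) * a := by ring

theorem Steps.improves {q : ℕ} (h : Steps H E T s R cap q k v R X X')
    (hR : H → ∀ Y : Finset V, q ^ R * (Y ∩ unsatisfied T s X).card < (q + 1) ^ R) :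
    Improves H E T s R cap (k + 1) v X X' where
  subset := h.subset
  edges := h.edges
  card_le := h.card_le
  eq_of_empty := h.eq_of_empty
  gain hH hv c Y hc hA := by
    have h1 := h.gain hH hv c Y hc hA
    have h3 : (q : ℤ) ^ R * (Y ∩ unsatisfied T s X).card < ((q : ℤ) + 1) ^ R := by
      exact_mod_cast hR hH Y
    have h4 : ((Y ∩ unsatisfied T s X).card : ℤ) + (unsatisfied T s X').card -
      (unsatisfied T s X).card < 1 := by
      by_contra hcon
      push Not at hcon
      have := mul_le_mul_of_nonneg_left hcon (show (0 : ℤ) ≤ ((q : ℤ) + 1) ^ R by positivity)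
      linarith
    omega

end Step

end SteinerForest

/-! ### Logical connectives and loops of the matrix language -/

namespace MatrixProgram

open SteinerForest

variable {n : ℕ}

/-- A term is regarded as true if its value is nonzero. -/
def Term.Holds (σ : Store n) (ρ : Env n) (e : Term) : Prop := e.val σ ρ ≠ 0

instance (σ : Store n) (ρ : Env n) (e : Term) : Decidable (e.Holds σ ρ) :=
  inferInstanceAs (Decidable (e.val σ ρ ≠ 0))

def Term.not (e : Term) : Term := .ite e (.const 0) (.const 1)
def Term.and (e f : Term) : Term := .ite e f (.const 0)
def Term.or (e f : Term) : Term := .ite e (.const 1) f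
def Term.lt (e f : Term) : Term := .sub f e
def Term.le (e f : Term) : Term := .not (.sub e f)
def Term.eq (e f : Term) : Term := .and (.le e f) (.le f e)

section Holds

variable {σ : Store n} {ρ : Env n}

theorem Term.val_const {c : ℕ} : (Term.const c).val σ ρ = c := rfl
theorem Term.val_var {x : ℕ} : (Term.var x).val σ ρ = ρ x := rfl
theorem Term.val_entry {a x y : ℕ} : (Term.entry a x y).val σ ρ = σ a (ρ x) (ρ y) := rfl
theorem Term.val_add {e f : Term} : (Term.add e f).val σ ρ = e.val σ ρ + f.val σ ρ := rfl

theorem Term.val_ite {c e f : Term} :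
    (Term.ite c e f).val σ ρ = if c.Holds σ ρ then e.val σ ρ else f.val σ ρ := rfl

theorem Term.val_not {e : Term} : (Term.not e).val σ ρ = if e.Holds σ ρ then 0 else 1 := by
  simp [Term.not, Term.val_ite, Term.val]

theorem Term.holds_not {e : Term} : (Term.not e).Holds σ ρ ↔ ¬ e.Holds σ ρ := by
  simp [Term.not, Term.Holds, Term.val]

theorem Term.holds_and {e f : Term} :
    (Term.and e f).Holds σ ρ ↔ e.Holds σ ρ ∧ f.Holds σ ρ := by
  by_cases h : e.val σ ρ = 0 <;> simp [Term.and, Term.Holds, Term.val, h]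

theorem Term.holds_or {e f : Term} :
    (Term.or e f).Holds σ ρ ↔ e.Holds σ ρ ∨ f.Holds σ ρ := by
  by_cases h : e.val σ ρ = 0 <;> simp [Term.or, Term.Holds, Term.val, h]

theorem Term.holds_lt {e f : Term} : (Term.lt e f).Holds σ ρ ↔ e.val σ ρ < f.val σ ρ := by
  simp [Term.lt, Term.Holds, Term.val, Nat.sub_ne_zero_iff_lt]

theorem Term.holds_le {e f : Term} : (Term.le e f).Holds σ ρ ↔ e.val σ ρ ≤ f.val σ ρ := by
  rw [Term.le, Term.holds_not]
  simp [Term.Holds, Term.val, Nat.sub_eq_zero_iff_le]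

theorem Term.holds_eq {e f : Term} : (Term.eq e f).Holds σ ρ ↔ e.val σ ρ = f.val σ ρ := by
  rw [Term.eq, Term.holds_and, Term.holds_le, Term.holds_le, le_antisymm_iff]

theorem Term.holds_entry {a x y : ℕ} :
    (Term.entry a x y).Holds σ ρ ↔ σ a (ρ x) (ρ y) ≠ 0 := Iff.rfl

theorem Term.holds_sum {x : ℕ} {e : Term} :
    (Term.sum x e).Holds σ ρ ↔ ∃ i, e.Holds σ (Function.update ρ x i) := by
  simp [Term.Holds, Term.val, Finset.sum_eq_zero_iff]

theorem Term.not_holds_const_zero : ¬ (Term.const 0).Holds σ ρ := by simp [Term.Holds, Term.val]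

theorem Term.val_sum_holds {x : ℕ} {e : Term}
    (h : ∀ i, e.val σ (Function.update ρ x i) ≤ 1) : (Term.sum x e).val σ ρ =
      (Finset.univ.filter fun i => e.Holds σ (Function.update ρ x i)).card := by
  rw [Finset.card_filter, Term.val]
  refine Finset.sum_congr rfl fun i _ => ?_
  have := h i
  split_ifs with hi
  · exact le_antisymm this (Nat.one_le_iff_ne_zero.2 hi)
  · exact not_not.1 hi

end Holds

theorem Cmd.run_seq (S S' : Cmd) (ρ : Env n) (σ : Store n) :
    (Cmd.seq S S').run ρ σ = S'.run ρ (S.run ρ σ) := rfl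

theorem Cmd.run_when (c : Term) (S : Cmd) (ρ : Env n) (σ : Store n) :
    (Cmd.when c S).run ρ σ = if c.Holds σ ρ then S.run ρ σ else σ := rfl

theorem Cmd.run_assign_self (a : ℕ) (e : Term) (ρ : Env n) (σ : Store n) (u v : Fin n) :
    (Cmd.assign a e).run ρ σ a u v = e.val σ (Function.update (Function.update ρ 0 u) 1 v) := by
  simp [Cmd.run]

theorem Cmd.run_assign_ne {a b : ℕ} (h : b ≠ a) (e : Term) (ρ : Env n) (σ : Store n) :
    (Cmd.assign a e).run ρ σ b = σ b := by
  simp [Cmd.run, h]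

/-- The command which copies the matrix `a` to the matrix `b`. -/
abbrev Cmd.copy (a b : ℕ) : Cmd := .assign b (.entry a 0 1)

theorem Cmd.run_copy_self (a b : ℕ) (ρ : Env n) (σ : Store n) :
    (Cmd.copy a b).run ρ σ b = σ a := by
  funext u v
  simp [Cmd.run, Term.val]

/-- The invariant rule for loops. -/
theorem Cmd.each_induction {x : ℕ} {S : Cmd} {ρ : Env n} {σ : Store n} (P : ℕ → Store n → Prop)
    (h0 : P 0 σ) (hs : ∀ (i : Fin n) σ', P i σ' → P (i + 1) (S.run (Function.update ρ x i) σ')) :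
    P n ((Cmd.each x S).run ρ σ) := by
  have key : ∀ k ≤ n, P k (((List.finRange n).take k).foldl
      (fun σ i => S.run (Function.update ρ x i) σ) σ) := by
    intro k
    induction k with
    | zero => intro _; simpa using h0
    | succ k ih =>
      intro hk
      rw [foldl_finRange_prefix _ _ k (by omega)]
      exact hs ⟨k, by omega⟩ _ (ih (by omega))
  have := key n le_rfl
  rwa [List.take_of_length_le (by simp)] at this

/-- The set of pairs at which a matrix is nonzero. -/
def support (M : Fin n → Fin n → ℕ) : Finset (Fin n × Fin n) :=
  Finset.univ.filter fun e => M e.1 e.2 ≠ 0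

theorem mem_support {M : Fin n → Fin n → ℕ} {u v : Fin n} :
    (u, v) ∈ support M ↔ M u v ≠ 0 := by
  simp [support]

/-! ### Reachability and distances -/

/-- Warshall's algorithm: the matrix `b` becomes the reflexive transitive closure of the matrix
`a`. -/
def closure (a b : ℕ) : Cmd :=
  .seq (.assign b (.or (.eq (.var 0) (.var 1)) (.entry a 0 1))) <|
    .each 5 (.assign b (.or (.entry b 0 1) (.and (.entry b 0 5) (.entry b 5 1))))

theorem closure_run_ne {a b c : ℕ} (h : c ≠ b) (ρ : Env n) (σ : Store n) :
    (closure a b).run ρ σ c = σ c := by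
  rw [closure, Cmd.run]
  refine Cmd.each_induction (fun _ σ' => σ' c = σ c) (Cmd.run_assign_ne h _ _ _) ?_
  intro i σ' hσ'
  rw [Cmd.run_assign_ne h, hσ']

theorem closure_run {a b : ℕ} (ρ : Env n) (σ : Store n) (u v : Fin n) :
    (closure a b).run ρ σ b u v ≠ 0 ↔ Reaches (support (σ a)) u v := by
  rw [closure, Cmd.run]
  have key := Cmd.each_induction (x := 5) (ρ := ρ)
    (S := .assign b (.or (.entry b 0 1) (.and (.entry b 0 5) (.entry b 5 1))))
    (σ := (Cmd.assign b (.or (.eq (.var 0) (.var 1)) (.entry a 0 1))).run ρ σ)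
    (fun k σ' => (∀ u v, σ' b u v ≠ 0 → Reaches (support (σ a)) u v) ∧
      (∀ u, σ' b u u ≠ 0) ∧ (∀ u v, σ a u v ≠ 0 → σ' b u v ≠ 0) ∧
      ∀ u (w : Fin n) v, (w : ℕ) < k → σ' b u w ≠ 0 → σ' b w v ≠ 0 → σ' b u v ≠ 0) ?_ ?_
  · obtain ⟨h1, h2, h3, h4⟩ := key
    refine ⟨h1 u v, fun h => ?_⟩
    induction h with
    | refl => exact h2 u
    | @tail x y _ hxy ih => exact h4 u x y x.2 ih (h3 _ _ (mem_support.1 hxy))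
  · have hb : ∀ u v, (Cmd.assign b (.or (.eq (.var 0) (.var 1)) (.entry a 0 1))).run ρ σ b u v ≠ 0
        ↔ u = v ∨ σ a u v ≠ 0 := by
      intro u v
      rw [Cmd.run_assign_self, ← Term.Holds, Term.holds_or, Term.holds_eq, Term.holds_entry]
      simp [Term.val, Fin.val_inj]
    simp only [hb]
    refine ⟨?_, fun u => Or.inl trivial, fun u v h => Or.inr h, fun u w v h => absurd h (by omega)⟩
    rintro u v (rfl | h)
    · exact .refl
    · exact .single (mem_support.2 h)
  · rintro i σ' ⟨h1, h2, h3, h4⟩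
    have hb : ∀ u v, (Cmd.assign b (.or (.entry b 0 1) (.and (.entry b 0 5) (.entry b 5 1)))).run
        (Function.update ρ 5 i) σ' b u v ≠ 0 ↔
        σ' b u v ≠ 0 ∨ σ' b u i ≠ 0 ∧ σ' b i v ≠ 0 := by
      intro u v
      rw [Cmd.run_assign_self, ← Term.Holds, Term.holds_or, Term.holds_and, Term.holds_entry,
        Term.holds_entry, Term.holds_entry]
      simp
    simp only [hb]
    refine ⟨?_, fun u => Or.inl (h2 u), fun u v h => Or.inl (h3 u v h), ?_⟩
    · rintro u v (h | ⟨h, h'⟩)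
      · exact h1 u v h
      · exact (h1 _ _ h).trans (h1 _ _ h')
    · intro u w v hw huw hwv
      rcases Nat.lt_succ_iff_lt_or_eq.1 hw with hw | hw
      · rcases huw with huw | ⟨hui, hiw⟩ <;> rcases hwv with hwv | ⟨hwi, hiv⟩
        · exact Or.inl (h4 u w v hw huw hwv)
        · exact Or.inr ⟨h4 u w i hw huw hwi, hiv⟩
        · exact Or.inr ⟨hui, h4 i w v hw hiw hwv⟩
        · exact Or.inr ⟨hui, hiv⟩
      · obtain rfl : w = i := Fin.ext hw
        exact Or.inr ⟨by tauto, by tauto⟩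

/-- Floyd's algorithm: the matrix 3 becomes the distance matrix of the digraph with adjacency
matrix 0, where all values `≥ n` mean that there is no path. -/
def distances : Cmd :=
  .seq (.assign 3 (.ite (.eq (.var 0) (.var 1)) (.const 0)
      (.ite (.entry 0 0 1) (.const 1) (.sum 2 (.const 1))))) <|
    .each 5 (.assign 3 (.ite (.lt (.add (.entry 3 0 5) (.entry 3 5 1)) (.entry 3 0 1))
      (.add (.entry 3 0 5) (.entry 3 5 1)) (.entry 3 0 1)))

theorem distances_run_ne {c : ℕ} (h : c ≠ 3) (ρ : Env n) (σ : Store n) :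
    distances.run ρ σ c = σ c := by
  rw [distances, Cmd.run]
  refine Cmd.each_induction (fun _ σ' => σ' c = σ c) (Cmd.run_assign_ne h _ _ _) ?_
  intro i σ' hσ'
  rw [Cmd.run_assign_ne h, hσ']

theorem distances_run (E : Fin n → Fin n → Prop) (ρ : Env n) (σ : Store n)
    (hE : ∀ u v, σ 0 u v ≠ 0 ↔ E u v) :
    IsDistance E (distances.run ρ σ 3) ∧
      ∀ u v, distances.run ρ σ 3 u v < n → Walk E (distances.run ρ σ 3 u v) u v := by
  rw [distances, Cmd.run]
  set S : Cmd := .assign 3 (.ite (.lt (.add (.entry 3 0 5) (.entry 3 5 1)) (.entry 3 0 1))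
      (.add (.entry 3 0 5) (.entry 3 5 1)) (.entry 3 0 1)) with hS
  set σ₀ := (Cmd.assign 3 (.ite (.eq (.var 0) (.var 1)) (.const 0)
      (.ite (.entry 0 0 1) (.const 1) (.sum 2 (.const 1))))).run ρ σ with hσ₀
  have key := Cmd.each_induction (x := 5) (ρ := ρ) (S := S) (σ := σ₀)
    (fun k σ' => (∀ u v, σ' 3 u v < n → Walk E (σ' 3 u v) u v) ∧
      (∀ u, σ' 3 u u = 0) ∧ (∀ u v, E u v → σ' 3 u v ≤ 1) ∧
      ∀ u (w : Fin n) v, (w : ℕ) < k → σ' 3 u v ≤ σ' 3 u w + σ' 3 w v) ?_ ?_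
  · obtain ⟨h1, h2, h3, h4⟩ := key
    refine ⟨⟨h2, fun u v w he => ?_⟩, h1⟩
    have := h4 u v w v.2
    have := h3 u v he
    omega
  · have hb : ∀ u v, σ₀ 3 u v = if u = v then 0 else if σ 0 u v ≠ 0 then 1 else n := by
      intro u v
      rw [hσ₀, Cmd.run_assign_self]
      simp only [Term.val_ite, Term.holds_eq, Term.holds_entry]
      simp [Term.val, Fin.val_inj]
    refine ⟨?_, fun u => by simp [hb], fun u v h => ?_, fun u w v h => absurd h (by omega)⟩
    · intro u v h
      rw [hb] at h ⊢
      split_ifs at h ⊢ with h1 h2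
      · subst h1; exact .nil u
      · exact .cons ((hE u v).1 h2) (.nil v)
      · omega
    · rw [hb, if_pos ((hE u v).2 h)]; split_ifs <;> simp
  · rintro i σ' ⟨h1, h2, h3, h4⟩
    have hb : ∀ u v, S.run (Function.update ρ 5 i) σ' 3 u v =
        min (σ' 3 u v) (σ' 3 u i + σ' 3 i v) := by
      intro u v
      rw [hS, Cmd.run_assign_self]
      simp only [Term.val_ite, Term.holds_lt, Term.val_add, Term.val_entry]
      simp
      split_ifs <;> omega
    simp only [hb]
    refine ⟨?_, fun u => by simp [h2], fun u v h => (min_le_left _ _).trans (h3 u v h), ?_⟩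
    · intro u v h
      rcases le_total (σ' 3 u v) (σ' 3 u i + σ' 3 i v) with hle | hle
      · rw [min_eq_left hle] at h ⊢
        exact h1 u v h
      · rw [min_eq_right hle] at h ⊢
        exact (h1 u i (by omega)).append (h1 i v (by omega))
    · intro u w v hw
      rcases Nat.lt_succ_iff_lt_or_eq.1 hw with hw | hw
      · have := h4 u w v hw
        have := h4 u w i hw
        have := h4 i w v hw
        omega
      · obtain rfl : w = i := Fin.ext hw
        have := h2 w
        omega

/-- The matrix 4 becomes the matrix of the first vertices after `x` on shortest paths from `x` to
`u`. -/
def nextHops : Cmd :=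
  .assign 4 (.sum 2 (.not (.sum 3 (.and (.le (.var 3) (.var 2))
    (.and (.entry 0 0 3) (.eq (.add (.entry 3 3 1) (.const 1)) (.entry 3 0 1)))))))

theorem nextHops_run {E : Fin n → Fin n → Prop} (ρ : Env n) (σ : Store n)
    (hE : ∀ u v, σ 0 u v ≠ 0 ↔ E u v) {x u : Fin n}
    (h : ∃ w, E x w ∧ σ 3 w u + 1 = σ 3 x u) :
    ∃ w : Fin n, nextHops.run ρ σ 4 x u = w ∧ E x w ∧ σ 3 w u + 1 = σ 3 x u := by
  classical
  set A : Finset (Fin n) := Finset.univ.filter fun w => E x w ∧ σ 3 w u + 1 = σ 3 x u with hA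
  have hne : A.Nonempty := by
    obtain ⟨w, hw⟩ := h
    exact ⟨w, by simpa [hA] using hw⟩
  refine ⟨A.min' hne, ?_, (Finset.mem_filter.1 (A.min'_mem hne)).2⟩
  -- the value counts the vertices before the first one with the required property
  rw [nextHops, Cmd.run_assign_self, Term.val_sum_holds]
  · rw [← Fin.card_Iio]
    congr 1
    ext w
    rw [Finset.mem_filter, Finset.mem_Iio, Term.holds_not, Term.holds_sum, Finset.lt_min'_iff]
    simp only [Term.holds_and, Term.holds_le, Term.holds_entry, Term.holds_eq]
    simp only [hE, hA, Finset.mem_filter, Finset.mem_univ, true_and]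
    simp [Term.val]
    constructor
    · intro h' i hi hi'
      by_contra hcon
      exact h' i (by simpa using hcon) hi hi'
    · intro h' i hle hi hi'
      exact absurd hle (not_le.2 (h' i hi hi'))
  · intro i
    rw [Term.val_not]
    split_ifs <;> simp

end MatrixProgram

/-! ### Adding shortest paths -/

namespace MatrixProgram

open SteinerForest

variable {n : ℕ}

/-- The matrices 0, 1, 3, 4 of the store `σ` hold the digraph `E`, the terminal pairs `T`, the
distances, and the next vertices on shortest paths. -/
structure Prepared (E : Fin n → Fin n → Prop) (T : Finset (Fin n × Fin n)) (σ : Store n) :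
    Prop where
  graph : ∀ u v, σ 0 u v ≠ 0 ↔ E u v
  terminals : ∀ u v, σ 1 u v ≠ 0 ↔ (u, v) ∈ T
  dist : IsDistance E (σ 3)
  eq_of_dist : ∀ u v, σ 3 u v = 0 → u = v
  hop : ∀ x u, σ 3 x u < n → σ 3 x u ≠ 0 → ∃ w : Fin n, σ 4 x u = w ∧ E x w ∧
    σ 3 w u + 1 = σ 3 x u

theorem Prepared.congr {E : Fin n → Fin n → Prop} {T : Finset (Fin n × Fin n)} {σ σ' : Store n}
    (h : Prepared E T σ) (h' : ∀ a < 5, a ≠ 2 → σ' a = σ a) : Prepared E T σ' := by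
  obtain ⟨h1, h2, h3, h4, h5⟩ := h
  rw [← h' 0 (by omega) (by omega)] at h1
  rw [← h' 1 (by omega) (by omega)] at h2
  rw [← h' 3 (by omega) (by omega)] at h3 h4 h5
  rw [← h' 4 (by omega) (by omega)] at h5
  exact ⟨h1, h2, h3, h4, h5⟩

theorem prepare_run {E : Fin n → Fin n → Prop} {T : Finset (Fin n × Fin n)} (ρ : Env n)
    (σ : Store n) (hE : ∀ u v, σ 0 u v ≠ 0 ↔ E u v) (hT : ∀ u v, σ 1 u v ≠ 0 ↔ (u, v) ∈ T) :
    Prepared E T ((Cmd.seq distances nextHops).run ρ σ) := by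
  obtain ⟨hd, hw⟩ := distances_run E ρ σ hE
  have hE' : ∀ u v, distances.run ρ σ 0 u v ≠ 0 ↔ E u v := by
    rwa [distances_run_ne (by omega)]
  have hσ : ∀ a, a ≠ 4 → (Cmd.seq distances nextHops).run ρ σ a = distances.run ρ σ a :=
    fun a ha => Cmd.run_assign_ne ha _ _ _
  constructor
  · rwa [hσ 0 (by omega)]
  · rwa [hσ 1 (by omega), distances_run_ne (by omega)]
  · rwa [hσ 3 (by omega)]
  · intro u v h
    rw [hσ 3 (by omega)] at h
    have := hw u v (by rw [h]; exact u.pos)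
    rw [h] at this
    cases this
    rfl
  · intro x u hlt h0
    rw [hσ 3 (by omega)] at hlt h0 ⊢
    refine nextHops_run ρ _ hE' ?_
    have := hw x u hlt
    obtain ⟨k, hk⟩ := Nat.exists_eq_succ_of_ne_zero h0
    rw [hk] at this ⊢
    cases this with
    | cons he hwalk =>
      have h1 := hd.le_of_walk hwalk
      have h2 := hd.le_add _ _ u he
      exact ⟨_, he, by omega⟩

/-- Add to the matrix `a` the edges of a shortest path from the vertex `v` to the vertex `u`.  The
rows of the current vertex on the path are marked in the matrix 5. -/
def addPath (a v u : ℕ) : Cmd :=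
  .seq (.assign 5 (.eq (.var 0) (.var v))) <| .each 5 <| .seq
    (.assign a (.or (.entry a 0 1)
      (.and (.entry 5 0 0) (.and (.entry 3 0 u) (.eq (.entry 4 0 u) (.var 1))))))
    (.assign 5 (.sum 2 (.and (.entry 5 2 2) (.and (.entry 3 2 u) (.eq (.entry 4 2 u) (.var 0))))))

theorem addPath_run_ne {a v u c : ℕ} (hc : c ≠ a) (hc' : c ≠ 5) (ρ : Env n) (σ : Store n) :
    (addPath a v u).run ρ σ c = σ c := by
  rw [addPath, Cmd.run]
  refine Cmd.each_induction (fun _ σ' => σ' c = σ c) (Cmd.run_assign_ne hc' _ _ _) ?_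
  intro i σ' hσ'
  rw [Cmd.run, Cmd.run_assign_ne hc', Cmd.run_assign_ne hc, hσ']

theorem addPath_run {E : Fin n → Fin n → Prop} {T : Finset (Fin n × Fin n)} {a v u : ℕ}
    (ha : 5 < a) (hv : 5 < v) (hu : 5 < u) (ρ : Env n) (σ : Store n) (hσ : Prepared E T σ) {m : ℕ}
    (hm : σ 3 (ρ v) (ρ u) ≤ m) (hmn : m < n) :
    AddsPath E m (ρ v) (ρ u) (support (σ a)) (support ((addPath a v u).run ρ σ a)) := by
  rw [addPath, Cmd.run]
  set S : Cmd := .seq (.assign a (.or (.entry a 0 1)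
      (.and (.entry 5 0 0) (.and (.entry 3 0 u) (.eq (.entry 4 0 u) (.var 1))))))
    (.assign 5 (.sum 2 (.and (.entry 5 2 2) (.and (.entry 3 2 u) (.eq (.entry 4 2 u) (.var 0))))))
    with hS
  have key := Cmd.each_induction (x := 5) (ρ := ρ) (S := S)
    (σ := (Cmd.assign 5 (.eq (.var 0) (.var v))).run ρ σ)
    (fun k σ' => (∀ c, c ≠ a → c ≠ 5 → σ' c = σ c) ∧ support (σ a) ⊆ support (σ' a) ∧
      (∀ e ∈ support (σ' a), e ∈ support (σ a) ∨ E e.1 e.2) ∧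
      (support (σ' a)).card ≤ (support (σ a)).card + min k (σ 3 (ρ v) (ρ u)) ∧
      ((∃ w, (∀ x y, σ' 5 x y ≠ 0 ↔ x = w) ∧ σ 3 w (ρ u) + k = σ 3 (ρ v) (ρ u) ∧
        Reaches (support (σ' a)) (ρ v) w) ∨
      (∀ x y, ¬ σ' 5 x y ≠ 0) ∧ Reaches (support (σ' a)) (ρ v) (ρ u))) ?_ ?_
  · obtain ⟨-, h1, h2, h3, h4⟩ := key
    refine ⟨h1, h2, by omega, ?_⟩
    rcases h4 with ⟨w, -, h4, -⟩ | ⟨-, h4⟩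
    · omega
    · exact h4
  · have hσa : (Cmd.assign 5 (.eq (.var 0) (.var v))).run ρ σ a = σ a :=
      Cmd.run_assign_ne (by omega) _ _ _
    rw [hσa]
    refine ⟨fun c _ hc => Cmd.run_assign_ne hc _ _ _, subset_rfl, fun e he => Or.inl he,
      by simp, Or.inl ⟨ρ v, fun x y => ?_, by simp, .refl⟩⟩
    rw [Cmd.run_assign_self, ← Term.Holds, Term.holds_eq, Term.val_var, Term.val_var]
    simp [show v ≠ 0 by omega, show v ≠ 1 by omega, Fin.val_inj]
  · rintro i σ' ⟨h0, h1, h2, h3, h4⟩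
    set τ := S.run (Function.update ρ 5 i) σ' with hτ
    have hτc : ∀ c, c ≠ a → c ≠ 5 → τ c = σ c := fun c hc hc' => by
      rw [hτ, hS, Cmd.run, Cmd.run_assign_ne hc', Cmd.run_assign_ne hc, h0 c hc hc']
    have hτa : ∀ x y, τ a x y ≠ 0 ↔ σ' a x y ≠ 0 ∨
        σ' 5 x x ≠ 0 ∧ σ 3 x (ρ u) ≠ 0 ∧ σ 4 x (ρ u) = y := by
      intro x y
      rw [hτ, hS, Cmd.run, Cmd.run_assign_ne (by omega), Cmd.run_assign_self, ← Term.Holds,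
        ← h0 3 (by omega) (by omega), ← h0 4 (by omega) (by omega)]
      simp only [Term.holds_or, Term.holds_and, Term.holds_entry, Term.holds_eq, Term.val_entry,
        Term.val_var]
      simp [show u ≠ 0 by omega, show u ≠ 1 by omega,
        show u ≠ 5 by omega]
    have hτ5 : ∀ x y, τ 5 x y ≠ 0 ↔ ∃ w, σ' 5 w w ≠ 0 ∧ σ 3 w (ρ u) ≠ 0 ∧ σ 4 w (ρ u) = x := by
      intro x y
      have hr : ∀ c, c ≠ a → (Cmd.assign a (.or (.entry a 0 1) (.and (.entry 5 0 0)
          (.and (.entry 3 0 u) (.eq (.entry 4 0 u) (.var 1)))))).run (Function.update ρ 5 i) σ' c =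
          σ' c := fun c hc => Cmd.run_assign_ne hc _ _ _
      rw [hτ, hS, Cmd.run, Cmd.run_assign_self, ← Term.Holds,
        ← h0 3 (by omega) (by omega), ← h0 4 (by omega) (by omega)]
      simp only [Term.holds_sum, Term.holds_and, Term.holds_entry, Term.holds_eq, Term.val_entry,
        Term.val_var, hr 3 (by omega), hr 4 (by omega), hr 5 (by omega)]
      simp [show u ≠ 0 by omega, show u ≠ 1 by omega,
        show u ≠ 5 by omega, show u ≠ 2 by omega]
    have hsub : support (σ' a) ⊆ support (τ a) := fun ⟨x, y⟩ hxy => by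
      rw [mem_support, hτa]; exact Or.inl (mem_support.1 hxy)
    -- once the end of the path is reached, a step changes nothing but the marks
    have hidle : (∀ w, σ' 5 w w ≠ 0 → σ 3 w (ρ u) = 0) →
        Reaches (support (σ' a)) (ρ v) (ρ u) →
        (support (τ a)).card ≤ (support (σ' a)).card ∧ (∀ e ∈ support (τ a), e ∈ support (σ' a)) ∧
        ((∀ x y, ¬ τ 5 x y ≠ 0) ∧ Reaches (support (τ a)) (ρ v) (ρ u)) := by
      intro hw hr
      have hsub' : ∀ e ∈ support (τ a), e ∈ support (σ' a) := by
        rintro ⟨x, y⟩ hxy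
        rw [mem_support, hτa] at hxy
        rcases hxy with hxy | ⟨hx, hx', -⟩
        · exact mem_support.2 hxy
        · exact absurd (hw x hx) hx'
      refine ⟨Finset.card_le_card hsub', hsub', fun x y hxy => ?_, hr.mono hsub⟩
      obtain ⟨w, hw1, hw2, -⟩ := (hτ5 x y).1 hxy
      exact hw2 (hw w hw1)
    refine ⟨hτc, h1.trans hsub, ?_⟩
    rcases h4 with ⟨w, hw, hdw, hr⟩ | ⟨h5, hr⟩
    · by_cases hz : σ 3 w (ρ u) = 0
      · obtain rfl := hσ.eq_of_dist _ _ hz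
        obtain ⟨g1, g2, g3⟩ := hidle (fun x hx => by rw [(hw x x).1 hx]; exact hz) hr
        exact ⟨fun e he => h2 e (g2 e he), by omega, Or.inr g3⟩
      · obtain ⟨z, hz1, hz2, hz3⟩ := hσ.hop w (ρ u) (by omega) hz
        have hins : support (τ a) = insert (w, z) (support (σ' a)) := by
          ext ⟨x, y⟩
          rw [Finset.mem_insert, mem_support, mem_support, hτa, Prod.mk.injEq, hw]
          constructor
          · rintro (h | ⟨rfl, -, h⟩)
            · exact Or.inr h
            · exact Or.inl ⟨rfl, Fin.ext (h ▸ hz1)⟩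
          · rintro (⟨rfl, rfl⟩ | h)
            · exact Or.inr ⟨rfl, hz, hz1⟩
            · exact Or.inl h
        refine ⟨?_, ?_, Or.inl ⟨z, fun x y => ?_, by omega, ?_⟩⟩
        · intro e he
          rw [hins, Finset.mem_insert] at he
          rcases he with rfl | he
          · exact Or.inr hz2
          · exact h2 e he
        · rw [hins]
          have := Finset.card_insert_le (w, z) (support (σ' a))
          omega
        · rw [hτ5]
          constructor
          · rintro ⟨w', hw', -, h⟩
            rw [(hw w' w').1 hw', hz1] at h
            exact (Fin.ext h).symm
          · rintro rfl
            exact ⟨w, (hw w w).2 rfl, hz, hz1⟩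
        · exact (hr.mono hsub).tail (by rw [hins]; exact Finset.mem_insert_self _ _)
    · obtain ⟨g1, g2, g3⟩ := hidle (fun x hx => absurd hx (h5 x x)) hr
      exact ⟨fun e he => h2 e (g2 e he), by omega, Or.inr g3⟩

/-! ### The greedy algorithm as a matrix program -/

/-- `k` levels of the greedy algorithm for the source in the variable `s`.  The edges bought by
level `j` are in the matrix `2 * j + 8`, and the best result of the current step of level `j` in
the matrix `2 * j + 9`; the root of level `j` is in the variable `2 * j + 8`, its bound `cap j` in
the variable `2 * j + 7`, and the number of steps of each level in the variable 7. -/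
def greedy (s : ℕ) : ℕ → Cmd
  | 0 => .skip
  | k + 1 => .each 6 <| .when (.lt (.var 6) (.var 7)) <|
      .seq (.copy (2 * (k + 1) + 8) (2 * (k + 1) + 9)) <| .seq
        (.each (2 * k + 8) <|
          .when (.le (.entry 3 (2 * (k + 1) + 8) (2 * k + 8)) (.var (2 * (k + 1) + 7))) <|
          .seq (.copy (2 * (k + 1) + 8) (2 * k + 8)) <|
          .seq (addPath (2 * k + 8) (2 * (k + 1) + 8) (2 * k + 8)) <|
          .seq (greedy s k) <|
          .seq (closure (2 * k + 8) 6) <|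
          .seq (closure (2 * (k + 1) + 9) 7) <|
          .when (.lt (.sum 2 (.and (.entry 1 s 2) (.not (.entry 6 s 2))))
            (.sum 2 (.and (.entry 1 s 2) (.not (.entry 7 s 2)))))
            (.copy (2 * k + 8) (2 * (k + 1) + 9)))
        (.copy (2 * (k + 1) + 9) (2 * (k + 1) + 8))

theorem val_unsatisfied {T : Finset (Fin n × Fin n)} {X : Finset (Fin n × Fin n)} {σ : Store n}
    {ρ : Env n} {c s : ℕ} (hs : s ≠ 2) (hT : ∀ u v, σ 1 u v ≠ 0 ↔ (u, v) ∈ T)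
    (hc : ∀ u v, σ c u v ≠ 0 ↔ Reaches X u v) :
    (Term.sum 2 (.and (.entry 1 s 2) (.not (.entry c s 2)))).val σ ρ =
      (unsatisfied T (ρ s) X).card := by
  rw [Term.val_sum_holds]
  · congr 1
    ext t
    rw [Finset.mem_filter, mem_unsatisfied]
    simp [Term.holds_and, Term.holds_not, Term.holds_entry, -ne_eq, hT, hc,
      Function.update_of_ne hs]
  · intro i
    rw [Term.and, Term.val_ite, Term.val_not, Term.val_const]
    split_ifs <;> simp

theorem greedy_run_ne (s : ℕ) : ∀ (k c : ℕ), c < 5 ∨ 2 * k + 9 < c → ∀ (ρ : Env n) (σ : Store n),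
    (greedy s k).run ρ σ c = σ c := by
  intro k
  induction k with
  | zero => intro c _ ρ σ; rfl
  | succ k ih =>
    intro c hc ρ σ
    rw [greedy]
    refine Cmd.each_induction (fun _ σ' => σ' c = σ c) rfl fun i σ' hσ' => ?_
    rw [Cmd.run_when]
    split_ifs with h6
    · rw [Cmd.run_seq, Cmd.run_seq, Cmd.run_assign_ne (by omega)]
      refine Cmd.each_induction (fun _ τ => τ c = σ c) ?_ fun j τ hτ => ?_
      · rw [Cmd.run_assign_ne (by omega), hσ']
      · rw [Cmd.run_when]
        split_ifs with hle
        · have hrun : ∀ τ' : Store n, τ' c = σ c →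
              (Cmd.when (.lt (.sum 2 (.and (.entry 1 s 2) (.not (.entry 6 s 2))))
                (.sum 2 (.and (.entry 1 s 2) (.not (.entry 7 s 2)))))
                (.copy (2 * k + 8) (2 * (k + 1) + 9))).run
                  (Function.update (Function.update ρ 6 i) (2 * k + 8) j) τ' c = σ c := by
            intro τ' hτ'
            rw [Cmd.run_when]
            split_ifs
            · rw [Cmd.run_assign_ne (by omega), hτ']
            · exact hτ'
          simp only [Cmd.run_seq]
          apply hrun
          rw [closure_run_ne (by omega), closure_run_ne (by omega), ih c (by omega),
            addPath_run_ne (by omega) (by omega), Cmd.run_assign_ne (by omega), hτ]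
        · exact hτ
    · exact hσ'

/-- The matrix program `greedy` has the properties from which the approximation guarantee of the
greedy algorithm follows. -/
theorem greedy_run {E : Fin n → Fin n → Prop} {T : Finset (Fin n × Fin n)} {H : Prop}
    {d : Fin n → Fin n → ℕ} {q R s : ℕ} {cap : ℕ → ℕ} {x : Fin n} (hs : 6 < s) (hcap : cap 0 = 0)
    (hR : H → ∀ X Y, q ^ R * (Y ∩ unsatisfied T x X).card < (q + 1) ^ R) (k : ℕ) :
    (∀ j < k, s ≠ 2 * j + 8) → (H → ∀ j < k, Splits E d q (cap (j + 1)) (cap j)) →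
    ∀ (ρ : Env n) (σ : Store n), Prepared E T σ → σ 3 = d →
      (∀ j, 1 ≤ j → j ≤ k → (ρ (2 * j + 7) : ℕ) = cap j) → (ρ 7 : ℕ) = R → ρ s = x →
      Improves H E T x R cap k (ρ (2 * k + 8)) (support (σ (2 * k + 8)))
        (support ((greedy s k).run ρ σ (2 * k + 8))) := by
  induction k with
  | zero =>
    intro _ _ ρ σ _ _ _ _ _
    exact Improves.refl hcap _ _
  | succ k ih =>
    intro hsv hsplit ρ σ hσ hd hρcap hρR hρs
    have ih := ih (fun j hj => hsv j (by omega)) (fun hH j hj => hsplit hH j (by omega))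
    have hsk := hsv k (by omega)
    have hcapn : cap (k + 1) < n := by
      rw [← hρcap (k + 1) (by omega) le_rfl]; exact (ρ _).2
    set v := ρ (2 * (k + 1) + 8) with hv
    have hRn : R < n := by rw [← hρR]; exact (ρ 7).2
    suffices h : Steps H E T x R cap q k v (min n R) (support (σ (2 * (k + 1) + 8)))
        (support ((greedy s (k + 1)).run ρ σ (2 * (k + 1) + 8))) by
      rw [min_eq_right hRn.le] at h
      exact h.improves fun hH Y => hR hH _ Y
    rw [greedy]
    refine (Cmd.each_induction (fun r σ' => (∀ c < 5, σ' c = σ c) ∧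
      Steps H E T x R cap q k v (min r R) (support (σ (2 * (k + 1) + 8)))
        (support (σ' (2 * (k + 1) + 8)))) ⟨fun _ _ => rfl, ?_⟩ ?_).2
    · rw [Nat.zero_min]; exact Steps.refl
    rintro i σ' ⟨hfr, hsteps⟩
    set ρ₁ := Function.update ρ 6 i with hρ₁
    rw [Cmd.run_when]
    have hcond : (Term.lt (.var 6) (.var 7)).Holds σ' ρ₁ ↔ (i : ℕ) < R := by
      rw [Term.holds_lt, Term.val_var, Term.val_var, ← hρR]
      simp [hρ₁]
    by_cases hi : (i : ℕ) < R
    swap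
    · rw [if_neg (by rwa [hcond])]
      refine ⟨hfr, ?_⟩
      rwa [show min ((i : ℕ) + 1) R = min (i : ℕ) R by omega]
    rw [if_pos (hcond.2 hi), Cmd.run_seq, Cmd.run_seq]
    set X := σ' (2 * (k + 1) + 8) with hX
    set σ₁ := (Cmd.copy (2 * (k + 1) + 8) (2 * (k + 1) + 9)).run ρ₁ σ' with hσ₁
    have hσ₁B : σ₁ (2 * (k + 1) + 9) = X := Cmd.run_copy_self _ _ _ _
    have hσ₁ne : ∀ c, c ≠ 2 * (k + 1) + 9 → σ₁ c = σ' c := fun c hc => Cmd.run_assign_ne hc _ _ _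
    have hloop := Cmd.each_induction (x := 2 * k + 8) (ρ := ρ₁) (σ := σ₁)
      (S := .when (.le (.entry 3 (2 * (k + 1) + 8) (2 * k + 8)) (.var (2 * (k + 1) + 7))) <|
          .seq (.copy (2 * (k + 1) + 8) (2 * k + 8)) <|
          .seq (addPath (2 * k + 8) (2 * (k + 1) + 8) (2 * k + 8)) <|
          .seq (greedy s k) <|
          .seq (closure (2 * k + 8) 6) <|
          .seq (closure (2 * (k + 1) + 9) 7) <|
          .when (.lt (.sum 2 (.and (.entry 1 s 2) (.not (.entry 6 s 2))))
            (.sum 2 (.and (.entry 1 s 2) (.not (.entry 7 s 2)))))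
            (.copy (2 * k + 8) (2 * (k + 1) + 9)))
      (fun j τ => (∀ c < 5, τ c = σ c) ∧ τ (2 * (k + 1) + 8) = X ∧
        BestStep H E d T x R cap k v {w | (w : ℕ) < j} (support X)
          (support (τ (2 * (k + 1) + 9)))) ?_ ?_
    · obtain ⟨g1, -, g2⟩ := hloop
      rw [show {w : Fin n | (w : ℕ) < n} = Set.univ from Set.eq_univ_of_forall fun w => w.2] at g2
      refine ⟨fun c hc => ?_, ?_⟩
      · rw [Cmd.run_assign_ne (by omega), g1 c hc]
      · rw [Cmd.run_copy_self, show min ((i : ℕ) + 1) R = min (i : ℕ) R + 1 by omega]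
        exact hsteps.succ (fun hH => hsplit hH k (by omega)) g2
    · refine ⟨fun c hc => ?_, ?_, ?_⟩
      · rw [hσ₁ne c (by omega), hfr c hc]
      · rw [hσ₁ne _ (by omega)]
      · rw [hσ₁B]
        simpa using BestStep.refl
    rintro j τ ⟨hτ, hτX, hbest⟩
    set ρ₂ := Function.update ρ₁ (2 * k + 8) j with hρ₂
    have hρ₂ne : ∀ y, y ≠ 6 → y ≠ 2 * k + 8 → ρ₂ y = ρ y := fun y h h' => by
      rw [hρ₂, hρ₁, Function.update_of_ne h', Function.update_of_ne h]
    have hρ₂j : ρ₂ (2 * k + 8) = j := Function.update_self _ _ _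
    have hset : {w : Fin n | (w : ℕ) < (j : ℕ) + 1} = insert j {w : Fin n | (w : ℕ) < j} := by
      ext w
      simp [Fin.ext_iff]
      omega
    rw [hset, Cmd.run_when]
    have hle : (Term.le (.entry 3 (2 * (k + 1) + 8) (2 * k + 8)) (.var (2 * (k + 1) + 7))).Holds
        τ ρ₂ ↔ d v j ≤ cap (k + 1) := by
      rw [Term.holds_le, Term.val_entry, Term.val_var, hρ₂j,
        hρ₂ne _ (by omega) (by omega), hρ₂ne _ (by omega) (by omega),
        hρcap (k + 1) (by omega) le_rfl, hτ 3 (by omega), hd]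
    by_cases hdj : d v j ≤ cap (k + 1)
    swap
    · rw [if_neg (by rwa [hle])]
      exact ⟨hτ, hτX, hbest.skip (by omega)⟩
    rw [if_pos (hle.2 hdj)]
    simp only [Cmd.run_seq]
    set τ₁ := (Cmd.copy (2 * (k + 1) + 8) (2 * k + 8)).run ρ₂ τ with hτ₁
    set τ₂ := (addPath (2 * k + 8) (2 * (k + 1) + 8) (2 * k + 8)).run ρ₂ τ₁ with hτ₂
    set τ₃ := (greedy s k).run ρ₂ τ₂ with hτ₃
    set τ₄ := (closure (2 * k + 8) 6).run ρ₂ τ₃ with hτ₄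
    set τ₅ := (closure (2 * (k + 1) + 9) 7).run ρ₂ τ₄ with hτ₅
    have h1 : ∀ c, c ≠ 2 * k + 8 → τ₁ c = τ c := fun c hc => Cmd.run_assign_ne hc _ _ _
    have h1X : τ₁ (2 * k + 8) = X := by rw [hτ₁, Cmd.run_copy_self, hτX]
    have h2 : ∀ c, c ≠ 2 * k + 8 → c ≠ 5 → τ₂ c = τ c := fun c hc hc' => by
      rw [hτ₂, addPath_run_ne hc hc', h1 c hc]
    have h3 : ∀ c, c < 5 ∨ 2 * k + 9 < c → τ₃ c = τ c := fun c hc => by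
      rw [hτ₃, greedy_run_ne s k c hc, h2 c (by omega) (by omega)]
    have h4 : ∀ c, c ≠ 6 → τ₄ c = τ₃ c := fun c hc => closure_run_ne hc _ _
    have h5 : ∀ c, c ≠ 6 → c ≠ 7 → τ₅ c = τ₃ c := fun c hc hc' => by
      rw [hτ₅, closure_run_ne hc', h4 c hc]
    have hp1 : Prepared E T τ₁ := hσ.congr fun c hc _ => by rw [h1 c (by omega), hτ c hc]
    have hp2 : Prepared E T τ₂ :=
      hσ.congr fun c hc _ => by rw [h2 c (by omega) (by omega), hτ c hc]
    have hadd : AddsPath E (cap (k + 1)) v j (support X) (support (τ₂ (2 * k + 8))) := by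
      have := addPath_run (E := E) (T := T) (a := 2 * k + 8) (v := 2 * (k + 1) + 8)
        (u := 2 * k + 8) (by omega) (by omega) (by omega) ρ₂ τ₁ hp1 (m := cap (k + 1)) ?_ hcapn
      · rwa [hρ₂j, hρ₂ne _ (by omega) (by omega), h1X] at this
      · rwa [hρ₂j, hρ₂ne _ (by omega) (by omega), h1 3 (by omega), hτ 3 (by omega), hd]
    have himp := ih ρ₂ τ₂ hp2 (by rw [h2 3 (by omega) (by omega), hτ 3 (by omega), hd])
      (fun j hj hj' => by
        rw [hρ₂ne _ (by omega) (by omega), hρcap j hj (by omega)])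
      (by rw [hρ₂ne _ (by omega) (by omega), hρR]) (by rw [hρ₂ne _ (by omega) hsk, hρs])
    rw [hρ₂j, ← hτ₃] at himp
    have hT5 : ∀ u v, τ₅ 1 u v ≠ 0 ↔ (u, v) ∈ T := by
      rw [h5 1 (by omega) (by omega), h3 1 (by omega), hτ 1 (by omega)]
      exact hσ.terminals
    have hu6 := val_unsatisfied (ρ := ρ₂) (σ := τ₅) (c := 6) (s := s) (by omega) hT5
      (X := support (τ₃ (2 * k + 8))) (by
        rw [hτ₅, closure_run_ne (by omega), hτ₄]
        exact closure_run ρ₂ τ₃)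
    have hu7 := val_unsatisfied (ρ := ρ₂) (σ := τ₅) (c := 7) (s := s) (by omega) hT5
      (X := support (τ (2 * (k + 1) + 9))) (by
        have := closure_run (a := 2 * (k + 1) + 9) (b := 7) ρ₂ τ₄
        rwa [h4 _ (by omega), h3 _ (by omega)] at this)
    have hρ₂s : ρ₂ s = x := by rw [hρ₂ne _ (by omega) hsk, hρs]
    rw [hρ₂s] at hu6 hu7
    rw [Cmd.run_when]
    have hlt := Term.holds_lt (σ := τ₅) (ρ := ρ₂)
      (e := .sum 2 (.and (.entry 1 s 2) (.not (.entry 6 s 2))))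
      (f := .sum 2 (.and (.entry 1 s 2) (.not (.entry 7 s 2))))
    rw [hu6, hu7] at hlt
    by_cases hcmp : (unsatisfied T x (support (τ₃ (2 * k + 8)))).card <
        (unsatisfied T x (support (τ (2 * (k + 1) + 9)))).card
    · rw [if_pos (hlt.2 hcmp)]
      refine ⟨fun c hc => ?_, ?_, ?_⟩
      · rw [Cmd.run_assign_ne (by omega), h5 c (by omega) (by omega), h3 c (by omega), hτ c hc]
      · rw [Cmd.run_assign_ne (by omega), h5 _ (by omega) (by omega), h3 _ (by omega), hτX]
      · rw [Cmd.run_copy_self, h5 _ (by omega) (by omega)]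
        exact hbest.take hadd himp hcmp
    · rw [if_neg (by rwa [hlt])]
      refine ⟨fun c hc => ?_, ?_, ?_⟩
      · rw [h5 c (by omega) (by omega), h3 c (by omega), hτ c hc]
      · rw [h5 _ (by omega) (by omega), h3 _ (by omega), hτX]
      · rw [h5 _ (by omega) (by omega), h3 _ (by omega)]
        exact hbest.keep hadd himp (not_lt.1 hcmp)

end MatrixProgram

/-! ### Candidate solutions -/

namespace MatrixProgram

open SteinerForest

variable {n : ℕ}

/-- The edge set `X` of the digraph `E` connects all terminal pairs. -/
def Feasible (E : Fin n → Fin n → Prop) (T X : Finset (Fin n × Fin n)) : Prop :=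
  (∀ e ∈ X, E e.1 e.2) ∧ ∀ s, unsatisfied T s X = ∅

/-- The number of sources with at least one nontrivial target. -/
noncomputable def sourceCount (T : Finset (Fin n × Fin n)) : ℕ :=
  (Finset.univ.filter fun s => (unsatisfied T s ∅).Nonempty).card

/-- Parameters for which `K` levels of the greedy algorithm with `R` steps each satisfy all targets
of every source: arborescences split as the analysis requires, `R` is large enough to bring the
number of missing targets below 1, and every source has an arborescence with at most `cap K` edges
to its targets. -/
structure Admissible (E : Fin n → Fin n → Prop) (d : Fin n → Fin n → ℕ)
    (T : Finset (Fin n × Fin n)) (q R : ℕ) (cap : ℕ → ℕ) (K : ℕ) : Prop where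
  splits : ∀ j < K, Splits E d q (cap (j + 1)) (cap j)
  lt_pow : ∀ s X Y, q ^ R * (Y ∩ unsatisfied T s X).card < (q + 1) ^ R
  arborescence : ∀ s, ∃ c Y, c ≤ cap K ∧ Arborescence E s c Y ∧ unsatisfied T s ∅ ⊆ Y

/-- The pair of the variables 0 and 1 is one of the `C` pairs of variables from number `b`
onwards. -/
def chosen (b : ℕ) : ℕ → Term
  | 0 => .const 0
  | C + 1 => .or (.and (.eq (.var 0) (.var (b + 2 * C))) (.eq (.var 1) (.var (b + 2 * C + 1))))
      (chosen b C)

theorem holds_chosen {b : ℕ} (hb : 1 < b) (C : ℕ) (σ : Store n) (ρ : Env n) (u v : Fin n) :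
    (chosen b C).Holds σ (Function.update (Function.update ρ 0 u) 1 v) ↔
      ∃ j < C, u = ρ (b + 2 * j) ∧ v = ρ (b + 2 * j + 1) := by
  induction C with
  | zero => simp [chosen, Term.not_holds_const_zero]
  | succ C ih =>
    have h : ∀ y, 1 < y → Function.update (Function.update ρ 0 u) 1 v y = ρ y := fun y hy => by
      rw [Function.update_of_ne (by omega), Function.update_of_ne (by omega)]
    rw [chosen, Term.holds_or, ih, Term.holds_and, Term.holds_eq, Term.holds_eq]
    simp only [Term.val_var, h _ (show 1 < b + 2 * C by omega),
      h _ (show 1 < b + 2 * C + 1 by omega)]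
    simp only [Function.update_self, Function.update_of_ne (show (0 : ℕ) ≠ 1 by omega),
      Fin.val_inj]
    constructor
    · rintro (h | ⟨j, hj, h⟩)
      · exact ⟨C, by omega, h⟩
      · exact ⟨j, by omega, h⟩
    · rintro ⟨j, hj, h⟩
      rcases Nat.lt_succ_iff_lt_or_eq.1 hj with hj | rfl
      · exact Or.inr ⟨j, hj, h⟩
      · exact Or.inl h

/-- Build a candidate in the matrix `2 * K + 8`: take the edges among `C` given pairs of distinct
vertices, and run the greedy algorithm for each source. -/
def build (K C : ℕ) : Cmd :=
  .seq (.assign (2 * K + 8) (.and (.entry 0 0 1)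
    (.and (.not (.eq (.var 0) (.var 1))) (chosen (2 * K + 10) C)))) <|
    .each (2 * K + 8) (greedy (2 * K + 8) K)

theorem build_run_ne {K C c : ℕ} (hc : c < 5) (ρ : Env n) (σ : Store n) :
    (build K C).run ρ σ c = σ c := by
  rw [build, Cmd.run_seq]
  refine Cmd.each_induction (fun _ σ' => σ' c = σ c) (Cmd.run_assign_ne (by omega) _ _ _) ?_
  intro i σ' hσ'
  rw [greedy_run_ne _ _ _ (Or.inl hc), hσ']

/-- The candidate consists of edges of the digraph.  If the set `X₀` of given edges already
connects all terminal pairs, nothing is added to it.  If `X₀` is empty and the parameters are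
admissible, all terminal pairs are connected at the cost of one run of the greedy algorithm for each
source that has nontrivial targets. -/
theorem build_run {E : Fin n → Fin n → Prop} {T : Finset (Fin n × Fin n)} {K C q : ℕ} {ρ : Env n}
    {σ : Store n} (hσ : Prepared E T σ) {cap : ℕ → ℕ} (hcap0 : cap 0 = 0)
    (hcap : ∀ j, 1 ≤ j → j ≤ K → (ρ (2 * j + 7) : ℕ) = cap j) {X₀ : Finset (Fin n × Fin n)}
    (hX₀ : ∀ u v, (u, v) ∈ X₀ ↔ E u v ∧ u ≠ v ∧
      ∃ j < C, u = ρ (2 * K + 10 + 2 * j) ∧ v = ρ (2 * K + 10 + 2 * j + 1)) :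
    (∀ e ∈ support ((build K C).run ρ σ (2 * K + 8)), E e.1 e.2) ∧
    ((∀ s, unsatisfied T s X₀ = ∅) → support ((build K C).run ρ σ (2 * K + 8)) = X₀) ∧
    (Admissible E (σ 3) T q (ρ 7) cap K → X₀ = ∅ →
      (∀ s, unsatisfied T s (support ((build K C).run ρ σ (2 * K + 8))) = ∅) ∧
      (support ((build K C).run ρ σ (2 * K + 8))).card ≤ sourceCount T * cost (ρ 7) cap K) := by
  rw [build, Cmd.run_seq]
  set σ₀ := (Cmd.assign (2 * K + 8) (.and (.entry 0 0 1)
    (.and (.not (.eq (.var 0) (.var 1))) (chosen (2 * K + 10) C)))).run ρ σ with hσ₀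
  have hσ₀ne : ∀ c < 5, σ₀ c = σ c := fun c hc => Cmd.run_assign_ne (by omega) _ _ _
  have hstart : support (σ₀ (2 * K + 8)) = X₀ := by
    ext ⟨u, v⟩
    rw [mem_support, hσ₀, Cmd.run_assign_self, ← Term.Holds, Term.holds_and, Term.holds_and,
      Term.holds_not, Term.holds_eq, Term.holds_entry, holds_chosen (by omega), hX₀]
    simp only [Term.val_var, Function.update_self,
      Function.update_of_ne (show (0 : ℕ) ≠ 1 by omega), hσ.graph, Fin.val_inj, ne_eq]
  set H : Prop := Admissible E (σ 3) T q (ρ 7) cap K with hH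
  have key := Cmd.each_induction (x := 2 * K + 8) (S := greedy (2 * K + 8) K) (ρ := ρ) (σ := σ₀)
    (fun k τ => (∀ c < 5, τ c = σ c) ∧ (∀ e ∈ support (τ (2 * K + 8)), E e.1 e.2) ∧
      X₀ ⊆ support (τ (2 * K + 8)) ∧
      ((∀ s, unsatisfied T s X₀ = ∅) → support (τ (2 * K + 8)) = X₀) ∧
      (H → X₀ = ∅ → (∀ s : Fin n, (s : ℕ) < k → unsatisfied T s (support (τ (2 * K + 8))) = ∅) ∧
        (support (τ (2 * K + 8))).card ≤ (Finset.univ.filter fun s : Fin n =>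
          (s : ℕ) < k ∧ (unsatisfied T s ∅).Nonempty).card * cost (ρ 7) cap K)) ?_ ?_
  · obtain ⟨-, h1, -, h2, h3⟩ := key
    refine ⟨h1, h2, fun h h' => ?_⟩
    obtain ⟨h4, h5⟩ := h3 h h'
    refine ⟨fun s => h4 s s.2, h5.trans ?_⟩
    simp [sourceCount]
  · refine ⟨hσ₀ne, ?_, hstart.ge, fun _ => hstart, fun _ h =>
      ⟨fun s hs => absurd hs (by omega), ?_⟩⟩
    · rw [hstart]
      rintro ⟨u, v⟩ huv
      exact ((hX₀ u v).1 huv).1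
    · rw [hstart, h]; simp
  · rintro i τ ⟨h0, h1, h2, h3, h4⟩
    have himp := greedy_run (E := E) (T := T) (H := H) (d := σ 3) (q := q) (R := ρ 7)
      (s := 2 * K + 8) (cap := cap) (x := i) (by omega) hcap0 (fun h => h.lt_pow i) K
      (fun j hj => by omega) (fun h => h.splits) (Function.update ρ (2 * K + 8) i) τ
      (hσ.congr fun c hc _ => h0 c hc) (h0 3 (by omega))
      (fun j hj hj' => by rw [Function.update_of_ne (by omega), hcap j hj hj'])
      (by rw [Function.update_of_ne (by omega)]) (Function.update_self _ _ _)
    rw [Function.update_self] at himp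
    set X := support (τ (2 * K + 8)) with hX
    set X' := support ((greedy (2 * K + 8) K).run (Function.update ρ (2 * K + 8) i) τ
      (2 * K + 8)) with hX'
    refine ⟨fun c hc => by rw [greedy_run_ne _ _ _ (Or.inl hc), h0 c hc],
      fun e he => (himp.edges e he).elim (h1 e) id, h2.trans himp.subset, fun h => ?_,
      fun h hE0 => ?_⟩
    · rw [himp.eq_of_empty (by rw [h3 h]; exact h i), h3 h]
    · obtain ⟨g1, g2⟩ := h4 h hE0
      have hdone : unsatisfied T i X' = ∅ := by
        obtain ⟨c, Y, hc, hA, hY⟩ := h.arborescence i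
        have hgain := himp.gain h .refl c Y hc hA
        have hsub : unsatisfied T i X ⊆ Y :=
          (unsatisfied_anti (Finset.empty_subset X)).trans hY
        rw [Finset.inter_eq_right.2 hsub] at hgain
        exact Finset.card_eq_zero.1 (by omega)
      refine ⟨fun s hs => ?_, ?_⟩
      · rcases Nat.lt_succ_iff_lt_or_eq.1 hs with hs | hs
        · exact Finset.subset_empty.1 (g1 s hs ▸ unsatisfied_anti himp.subset)
        · rw [Fin.ext hs]; exact hdone
      · by_cases hne : (unsatisfied T i ∅).Nonempty
        · have : (Finset.univ.filter fun s : Fin n => (s : ℕ) < i + 1 ∧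
              (unsatisfied T s ∅).Nonempty) = insert i (Finset.univ.filter fun s : Fin n =>
              (s : ℕ) < i ∧ (unsatisfied T s ∅).Nonempty) := by
            ext s
            simp only [Finset.mem_filter, Finset.mem_univ, true_and, Finset.mem_insert]
            constructor
            · rintro ⟨hs, hs'⟩
              rcases Nat.lt_succ_iff_lt_or_eq.1 hs with hs | hs
              · exact Or.inr ⟨hs, hs'⟩
              · exact Or.inl (Fin.ext hs)
            · rintro (rfl | ⟨hs, hs'⟩)
              · exact ⟨by omega, hne⟩
              · exact ⟨by omega, hs'⟩
          rw [this, Finset.card_insert_of_notMem (by simp), add_mul]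
          have := himp.card_le
          omega
        · have hempty : unsatisfied T i X = ∅ := Finset.subset_empty.1
            ((Finset.not_nonempty_iff_eq_empty.1 hne) ▸ unsatisfied_anti (Finset.empty_subset X))
          rw [himp.eq_of_empty hempty]
          refine g2.trans (Nat.mul_le_mul_right _ (Finset.card_le_card ?_))
          intro s
          simp only [Finset.mem_filter, Finset.mem_univ, true_and]
          exact fun hs => ⟨by omega, hs.2⟩

/-- The number of nonzero entries of the matrix `a`. -/
def size (a : ℕ) : Term := .sum 2 (.sum 3 (.ite (.entry a 2 3) (.const 1) (.const 0)))

theorem val_size (a : ℕ) (σ : Store n) (ρ : Env n) :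
    (size a).val σ ρ = (support (σ a)).card := by
  rw [support, Finset.card_filter, Fintype.sum_prod_type]
  simp [size, Term.val]

/-- Build a candidate, and if it connects all terminal pairs and is smaller than the edge set in
the matrix 2, store it there. -/
def candidate (K C : ℕ) : Cmd :=
  .seq (build K C) <| .seq (closure (2 * K + 8) 6) <|
    .when (.and (.not (.sum 2 (.sum 3 (.and (.entry 1 2 3) (.not (.entry 6 2 3))))))
      (.lt (size (2 * K + 8)) (size 2))) (.copy (2 * K + 8) 2)

theorem candidate_run {E : Fin n → Fin n → Prop} {T : Finset (Fin n × Fin n)} {K C : ℕ} {ρ : Env n}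
    {σ : Store n} (hσ : Prepared E T σ) (hE : Feasible E T (support (σ 2))) :
    (∀ c < 5, c ≠ 2 → (candidate K C).run ρ σ c = σ c) ∧
    Feasible E T (support ((candidate K C).run ρ σ 2)) ∧
    (support ((candidate K C).run ρ σ 2)).card ≤ (support (σ 2)).card ∧
    (Feasible E T (support ((build K C).run ρ σ (2 * K + 8))) →
      (support ((candidate K C).run ρ σ 2)).card ≤
        (support ((build K C).run ρ σ (2 * K + 8))).card) := by
  rw [candidate, Cmd.run_seq, Cmd.run_seq, Cmd.run_when]
  set σ₁ := (build K C).run ρ σ with hσ₁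
  set σ₂ := (closure (2 * K + 8) 6).run ρ σ₁ with hσ₂
  have h1 : ∀ c < 5, σ₁ c = σ c := fun c hc => build_run_ne hc _ _
  have h2 : ∀ c, c ≠ 6 → σ₂ c = σ₁ c := fun c hc => closure_run_ne hc _ _
  have hedges : ∀ e ∈ support (σ₁ (2 * K + 8)), E e.1 e.2 := by
    classical
    exact (build_run (q := 0) hσ (cap := fun j => if j = 0 then 0 else ρ (2 * j + 7)) rfl
      (fun j hj _ => by rw [if_neg (by omega)]) (X₀ := Finset.univ.filter fun e =>
        E e.1 e.2 ∧ e.1 ≠ e.2 ∧ ∃ j < C, e.1 = ρ (2 * K + 10 + 2 * j) ∧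
          e.2 = ρ (2 * K + 10 + 2 * j + 1)) (fun u v => by simp)).1
  have hcond : (Term.and (.not (.sum 2 (.sum 3 (.and (.entry 1 2 3) (.not (.entry 6 2 3))))))
      (.lt (size (2 * K + 8)) (size 2))).Holds σ₂ ρ ↔
      Feasible E T (support (σ₁ (2 * K + 8))) ∧
        (support (σ₁ (2 * K + 8))).card < (support (σ 2)).card := by
    rw [Term.holds_and, Term.holds_lt, val_size, val_size, h2 _ (by omega), h2 _ (by omega),
      h1 2 (by omega), Term.holds_not]
    refine and_congr ?_ Iff.rfl
    have h6 : ∀ u v, σ₂ 6 u v ≠ 0 ↔ Reaches (support (σ₁ (2 * K + 8))) u v := closure_run ρ σ₁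
    have hT : ∀ u v, σ₂ 1 u v ≠ 0 ↔ (u, v) ∈ T := by
      rw [h2 1 (by omega), h1 1 (by omega)]; exact hσ.terminals
    simp only [Term.holds_sum, Term.holds_and, Term.holds_not, Term.holds_entry]
    simp only [Function.update_self, Function.update_of_ne (show (2 : ℕ) ≠ 3 by omega), hT, h6]
    constructor
    · intro h
      refine ⟨hedges, fun s => Finset.eq_empty_of_forall_notMem fun t ht => ?_⟩
      exact h ⟨s, t, mem_unsatisfied.1 ht⟩
    · rintro ⟨-, h⟩ ⟨s, t, hst⟩
      have := mem_unsatisfied.2 hst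
      rw [h s] at this
      exact absurd this (Finset.notMem_empty _)
  split_ifs with h
  · obtain ⟨hf, hlt⟩ := hcond.1 h
    rw [Cmd.run_copy_self, h2 _ (by omega)]
    refine ⟨fun c hc hc' => ?_, hf, hlt.le, fun _ => le_rfl⟩
    rw [Cmd.run_assign_ne hc', h2 c (by omega), h1 c hc]
  · rw [h2 2 (by omega), h1 2 (by omega)]
    refine ⟨fun c hc _ => by rw [h2 c (by omega), h1 c hc], hE, le_rfl, fun hf => ?_⟩
    by_contra hlt
    exact h (hcond.2 ⟨hf, not_le.1 hlt⟩)

/-! ### Enumeration of the parameters -/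

/-- Execute `S` for all values of the variables `0, …, N - 1`. -/
def eachOver : ℕ → Cmd → Cmd
  | 0, S => S
  | N + 1, S => eachOver N (.each N S)

/-- If a property `P` is preserved by `S`, and `Q` is preserved as well and is established by one
particular choice of the variables, then both hold after the enumeration. -/
theorem eachOver_run {P Q : Store n → Prop} (ρ₀ : Env n) (N : ℕ) : ∀ (S : Cmd),
    (∀ ρ σ, P σ → P (S.run ρ σ)) → (∀ ρ σ, P σ → Q σ → Q (S.run ρ σ)) →
    (∀ ρ σ, P σ → (∀ x < N, ρ x = ρ₀ x) → Q (S.run ρ σ)) →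
    ∀ ρ σ, P σ → P ((eachOver N S).run ρ σ) ∧ Q ((eachOver N S).run ρ σ) := by
  induction N with
  | zero => intro S hP _ hS ρ σ hσ; exact ⟨hP ρ σ hσ, hS ρ σ hσ fun x hx => absurd hx (by omega)⟩
  | succ N ih =>
    intro S hP hQ hS
    refine ih (.each N S) (fun ρ σ hσ => ?_) (fun ρ σ hσ hq => ?_) (fun ρ σ hσ hρ => ?_)
    · exact Cmd.each_induction (fun _ τ => P τ) hσ fun i τ hτ => hP _ _ hτ
    · exact (Cmd.each_induction (fun _ τ => P τ ∧ Q τ) ⟨hσ, hq⟩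
        fun i τ hτ => ⟨hP _ _ hτ.1, hQ _ _ hτ.1 hτ.2⟩).2
    · refine (Cmd.each_induction (fun k τ => P τ ∧ ((ρ₀ N : ℕ) < k → Q τ))
        ⟨hσ, fun h => absurd h (by omega)⟩ fun i τ hτ => ⟨hP _ _ hτ.1, fun hi => ?_⟩).2 (ρ₀ N).2
      rcases Nat.lt_succ_iff_lt_or_eq.1 hi with hi | hi
      · exact hQ _ _ hτ.1 (hτ.2 hi)
      · refine hS _ _ hτ.1 fun x hx => ?_
        rcases Nat.lt_succ_iff_lt_or_eq.1 hx with hx | rfl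
        · rw [Function.update_of_ne (by omega), hρ x hx]
        · rw [Function.update_self, Fin.ext hi]

/-- The complete algorithm, with `K` levels of recursion and an exhaustive search for solutions
with at most `C` edges.  The numbers `R` and `cap 1, …, cap K` and the pairs of vertices for the
exhaustive search are enumerated. -/
def algorithm (K C : ℕ) : Cmd :=
  .seq (.copy 0 2) <| .seq (.seq distances nextHops) <|
    eachOver (2 * K + 10 + 2 * C) (candidate K C)

/-- Loops are never needed; hence a loop can stand for a missing edge in the exhaustive search. -/
theorem Feasible.filter_ne {E : Fin n → Fin n → Prop} {T X : Finset (Fin n × Fin n)}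
    (h : Feasible E T X) : Feasible E T (X.filter fun e => e.1 ≠ e.2) := by
  refine ⟨fun e he => h.1 e (Finset.mem_filter.1 he).1, fun s => ?_⟩
  refine Finset.eq_empty_of_forall_notMem fun t ht => ?_
  rw [mem_unsatisfied] at ht
  have hr : Reaches X s t := by
    by_contra hr
    have := mem_unsatisfied.2 ⟨ht.1, hr⟩
    rw [h.2 s] at this
    exact absurd this (Finset.notMem_empty _)
  refine ht.2 ?_
  clear ht
  induction hr with
  | refl => exact .refl
  | @tail a b _ hab ih =>
    by_cases hne : a = b
    · exact hne ▸ ih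
    · exact ih.tail (Finset.mem_filter.2 ⟨hab, hne⟩)

/-- The result of the algorithm is feasible, at most as large as every feasible set with at most `C`
edges, and at most as expensive as the greedy algorithm with any admissible parameters. -/
theorem algorithm_run {E : Fin n → Fin n → Prop} {T : Finset (Fin n × Fin n)} (K C : ℕ) (ρ : Env n)
    (σ : Store n) (hE : ∀ u v, σ 0 u v ≠ 0 ↔ E u v) (hT : ∀ u v, σ 1 u v ≠ 0 ↔ (u, v) ∈ T)
    (hfeas : Feasible E T (support (σ 0))) :
    ∃ d, IsDistance E d ∧ Feasible E T (support ((algorithm K C).run ρ σ 2)) ∧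
      (∀ X, Feasible E T X → X.card ≤ C →
        (support ((algorithm K C).run ρ σ 2)).card ≤ X.card) ∧
      ∀ q R cap, R < n → (∀ j, cap j < n) → cap 0 = 0 → Admissible E d T q R cap K →
        (support ((algorithm K C).run ρ σ 2)).card ≤ sourceCount T * cost R cap K := by
  classical
  rw [algorithm, Cmd.run_seq, Cmd.run_seq]
  set σ₀ := (Cmd.copy 0 2).run ρ σ with hσ₀
  set σ₁ := (Cmd.seq distances nextHops).run ρ σ₀ with hσ₁
  have h0 : σ₀ 0 = σ 0 := Cmd.run_assign_ne (by omega) _ _ _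
  have h1 : σ₀ 1 = σ 1 := Cmd.run_assign_ne (by omega) _ _ _
  have hp : Prepared E T σ₁ := prepare_run ρ σ₀ (by rwa [h0]) (by rwa [h1])
  have h2 : σ₁ 2 = σ 0 := by
    rw [hσ₁, Cmd.run_seq, nextHops, Cmd.run_assign_ne (by omega), distances_run_ne (by omega), hσ₀,
      Cmd.run_copy_self]
  set P : Store n → Prop := fun τ => Prepared E T τ ∧ τ 3 = σ₁ 3 ∧ Feasible E T (support (τ 2))
    with hP
  have hP₁ : P σ₁ := ⟨hp, rfl, by rwa [h2]⟩
  have hstep : ∀ ρ τ, P τ → P ((candidate K C).run ρ τ) := by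
    rintro ρ τ ⟨g1, g2, g3⟩
    obtain ⟨f1, f2, -⟩ := candidate_run (K := K) (C := C) (ρ := ρ) g1 g3
    exact ⟨g1.congr f1, by rw [f1 3 (by omega) (by omega), g2], f2⟩
  have main : ∀ (ρ₀ : Env n) (B : ℕ), (∀ ρ τ, P τ → (∀ x < 2 * K + 10 + 2 * C, ρ x = ρ₀ x) →
      (support ((candidate K C).run ρ τ 2)).card ≤ B) →
      Feasible E T (support ((eachOver (2 * K + 10 + 2 * C) (candidate K C)).run ρ σ₁ 2)) ∧
      (support ((eachOver (2 * K + 10 + 2 * C) (candidate K C)).run ρ σ₁ 2)).card ≤ B := by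
    intro ρ₀ B hB
    obtain ⟨g1, g2⟩ := eachOver_run (P := P) (Q := fun τ => (support (τ 2)).card ≤ B) ρ₀ _
      (candidate K C) hstep (fun ρ τ hτ hq =>
        (candidate_run (K := K) (C := C) (ρ := ρ) hτ.1 hτ.2.2).2.2.1.trans hq) hB ρ σ₁ hP₁
    exact ⟨g1.2.2, g2⟩
  refine ⟨σ₁ 3, hp.dist, ?_, ?_, ?_⟩
  · -- feasibility does not depend on the bound, so the trivial one will do
    refine (main ρ (n * n) fun ρ τ _ _ => ?_).1
    exact (Finset.card_le_univ _).trans (by simp)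
  · intro X hX hC
    set X₀ := X.filter fun e => e.1 ≠ e.2 with hX₀
    have hle : X₀.card ≤ X.card := Finset.card_filter_le _ _
    have hf : Feasible E T X₀ := hX.filter_ne
    set z : Fin n := ρ 0
    -- the edges are listed in the last variables, filled up with a loop
    set g : ℕ → Fin n × Fin n := fun j => X₀.toList.getD j (z, z) with hg
    set b := 2 * K + 10 with hb
    set ρ₀ : Env n := fun x => if (x - b) % 2 = 0 then (g ((x - b) / 2)).1 else (g ((x - b) / 2)).2
      with hρ₀
    refine (main ρ₀ X.card fun ρ τ hτ hρ => ?_).2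
    have hchosen : ∀ u v, (u, v) ∈ X₀ ↔ E u v ∧ u ≠ v ∧
        ∃ j < C, u = ρ (2 * K + 10 + 2 * j) ∧ v = ρ (2 * K + 10 + 2 * j + 1) := by
      intro u v
      have hval : ∀ j < C, ρ (2 * K + 10 + 2 * j) = (g j).1 ∧
          ρ (2 * K + 10 + 2 * j + 1) = (g j).2 := by
        intro j hj
        rw [hρ _ (by omega), hρ _ (by omega), hρ₀]
        constructor
        · dsimp only
          rw [if_pos (by omega), show (2 * K + 10 + 2 * j - b) / 2 = j by omega]
        · dsimp only
          rw [if_neg (by omega), show (2 * K + 10 + 2 * j + 1 - b) / 2 = j by omega]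
      constructor
      · intro h
        refine ⟨hf.1 _ h, (Finset.mem_filter.1 h).2, ?_⟩
        obtain ⟨j, hj, hjv⟩ := List.mem_iff_getElem.1 (Finset.mem_toList.2 h)
        rw [Finset.length_toList] at hj
        have hgj : g j = (u, v) := by
          rw [hg]; dsimp only
          rw [List.getD_eq_getElem _ _ (by rwa [Finset.length_toList]), hjv]
        refine ⟨j, by omega, ?_⟩
        obtain ⟨e1, e2⟩ := hval j (by omega)
        rw [e1, e2, hgj]
        exact ⟨rfl, rfl⟩
      · rintro ⟨-, hne, j, hj, hu, hv⟩
        obtain ⟨e1, e2⟩ := hval j hj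
        have hgj : g j = (u, v) := Prod.ext (by rw [← e1, hu]) (by rw [← e2, hv])
        by_cases hlen : j < X₀.toList.length
        · rw [hg] at hgj; dsimp only at hgj
          rw [List.getD_eq_getElem _ _ hlen] at hgj
          rw [← Finset.mem_toList, ← hgj]
          exact List.getElem_mem _
        · rw [hg] at hgj; dsimp only at hgj
          rw [List.getD_eq_default _ _ (by omega), Prod.mk.injEq] at hgj
          exact absurd (hgj.1.symm.trans hgj.2) hne
    obtain ⟨-, hb2, -⟩ := build_run (q := 0) hτ.1
      (cap := fun j => if j = 0 then 0 else ρ (2 * j + 7)) rfl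
      (fun j hj _ => by rw [if_neg (by omega)]) hchosen
    have hbX := hb2 hf.2
    have := (candidate_run (K := K) (C := C) (ρ := ρ) hτ.1 hτ.2.2).2.2.2 (by rwa [hbX])
    rw [hbX] at this
    exact this.trans hle
  · intro q R cap hR hcapn hcap0 hadm
    set z : Fin n := ρ 0
    set ρ₀ : Env n := fun x => if x = 7 then ⟨R, hR⟩ else if x < 2 * K + 10 then
      ⟨cap ((x - 7) / 2), hcapn _⟩ else z with hρ₀
    refine (main ρ₀ _ fun ρ τ hτ hρ => ?_).2
    have hρR : (ρ 7 : ℕ) = R := by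
      rw [hρ 7 (by omega), hρ₀]; dsimp only; rw [if_pos rfl]
    obtain ⟨hb1, -, hb3⟩ := build_run (K := K) (C := C) (q := q) hτ.1 (cap := cap)
      (ρ := ρ) (X₀ := ∅) hcap0
      (fun j hj hj' => by
        rw [hρ _ (by omega), hρ₀]; dsimp only
        rw [if_neg (by omega), if_pos (by omega), show (2 * j + 7 - 7) / 2 = j by omega])
      (fun u v => by
        refine ⟨fun h => absurd h (Finset.notMem_empty _), ?_⟩
        rintro ⟨-, hne, j, hj, hu, hv⟩
        refine absurd (hu.trans (Eq.trans ?_ hv.symm)) hne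
        rw [hρ _ (by omega), hρ _ (by omega), hρ₀]; dsimp only
        rw [if_neg (by omega), if_neg (by omega), if_neg (by omega), if_neg (by omega)])
    rw [hρR] at hb3
    obtain ⟨hb4, hb5⟩ := hb3 (by rw [hτ.2.1]; exact hadm) rfl
    exact ((candidate_run (K := K) (C := C) (ρ := ρ) hτ.1 hτ.2.2).2.2.2 ⟨hb1, hb4⟩).trans hb5

end MatrixProgram

/-! ### The choice of the parameters -/

namespace SteinerForest

/-- For every `m` above a constant there are numbers `q` and `R` as the greedy algorithm with
`ℓ + 1` levels needs them, such that its cost is at most `m ^ (1 + ε)`.  They are powers of the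
least `x` with `m ≤ x ^ (ℓ ^ 2)`, namely `q = x ^ ℓ` and `R = x ^ (ℓ + 1)`; since `(1 + 1 / q) ^ q`
is at least 2, `R = q * x` steps suffice as soon as `2 ^ x` exceeds `m`. -/
theorem exists_parameters {ε : ℝ} (hε : 0 < ε) : ∃ ℓ C : ℕ, ∀ m, C < m → ∃ q R : ℕ,
    m ≤ q ^ ℓ ∧ 2 ^ ℓ ≤ q ∧ q ≤ R ∧ q ^ R * m < (q + 1) ^ R ∧ R * R < m ∧
      (((ℓ + 1) * 2 ^ ℓ * R ^ (ℓ + 1) : ℕ) : ℝ) ≤ (m : ℝ) ^ (1 + ε) := by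
  obtain ⟨ℓ, hℓ4, hℓ⟩ : ∃ ℓ : ℕ, 4 ≤ ℓ ∧ (2 * ℓ + 4 : ℝ) ≤ ℓ ^ 2 * ε := by
    obtain ⟨k, hk⟩ := exists_nat_gt (4 / ε)
    refine ⟨k + 4, by omega, ?_⟩
    rw [div_lt_iff₀ hε] at hk
    push_cast
    have hk0 : (0 : ℝ) ≤ k := Nat.cast_nonneg k
    nlinarith [mul_nonneg hk0 hε.le]
  set N := ℓ ^ 2 with hN
  set M := (ℓ + 1) * 2 ^ ℓ with hM
  obtain ⟨x₁, hx₁⟩ : ∃ x₁ : ℕ, ∀ x ≥ x₁, x ^ N < 2 ^ x := by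
    have := (tendsto_pow_const_div_const_pow_of_one_lt N (show (1 : ℝ) < 2 by norm_num)).eventually
      (gt_mem_nhds one_pos)
    obtain ⟨x₁, hx₁⟩ := Filter.eventually_atTop.1 this
    refine ⟨x₁, fun x hx => ?_⟩
    have := hx₁ x hx
    rw [div_lt_one (by positivity)] at this
    exact_mod_cast this
  set x₀ := x₁ + 2 ^ N + M * 2 ^ (N + 2 * ℓ + 4) + 2 with hx₀
  refine ⟨ℓ, x₀ ^ N, fun m hm => ?_⟩
  have hN0 : N ≠ 0 := by positivity
  have hex : ∃ x : ℕ, m ≤ x ^ N := ⟨m, Nat.le_self_pow hN0 m⟩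
  obtain ⟨x, hx, hmin⟩ : ∃ x : ℕ, m ≤ x ^ N ∧ ∀ y < x, y ^ N < m :=
    ⟨Nat.find hex, Nat.find_spec hex, fun y hy => not_le.1 (Nat.find_min hex hy)⟩
  have hxx : x₀ < x := by
    by_contra hle
    exact absurd (hx.trans (Nat.pow_le_pow_left (not_lt.1 hle) N)) (not_le.2 hm)
  obtain ⟨hx₁x, hNx, hMx, h2x⟩ :
      x₁ < x ∧ 2 ^ N < x ∧ M * 2 ^ (N + 2 * ℓ + 4) < x ∧ 2 < x := by
    have aux : ∀ a b c : ℕ, a + b + c + 2 < x → a < x ∧ b < x ∧ c < x ∧ 2 < x := by omega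
    exact aux _ _ _ hxx
  have hpow : x ^ N < 2 ^ N * m := by
    calc x ^ N ≤ (2 * (x - 1)) ^ N := Nat.pow_le_pow_left (by omega) N
      _ = 2 ^ N * (x - 1) ^ N := mul_pow _ _ _
      _ < 2 ^ N * m := by
        have := hmin (x - 1) (by omega)
        gcongr
  have hx1 : 1 ≤ x := by omega
  refine ⟨x ^ ℓ, x ^ (ℓ + 1), ?_, ?_, Nat.pow_le_pow_right hx1 (by omega), ?_, ?_, ?_⟩
  · rw [← pow_mul, ← sq]; exact hx
  · exact Nat.pow_le_pow_left (by omega) ℓ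
  · set q := x ^ ℓ with hq
    have hq0 : 0 < q := by positivity
    have hbern : 2 * q ^ q ≤ (q + 1) ^ q := by
      have h := one_add_mul_le_pow (a := (1 / q : ℝ)) (by
        have : (0 : ℝ) ≤ 1 / q := by positivity
        linarith) q
      have hqr : (q : ℝ) ≠ 0 := by positivity
      rw [mul_one_div_cancel hqr, show (1 + 1 / q : ℝ) = (q + 1) / q by field_simp, div_pow,
        le_div_iff₀ (by positivity)] at h
      have h' : (2 : ℝ) * q ^ q ≤ (q + 1) ^ q := by linarith
      exact_mod_cast h'
    have hR : x ^ (ℓ + 1) = q * x := pow_succ _ _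
    rw [hR, pow_mul, pow_mul]
    calc (q ^ q) ^ x * m < (q ^ q) ^ x * 2 ^ x := by
          have := hx.trans_lt (hx₁ x (by omega))
          gcongr
      _ = (2 * q ^ q) ^ x := by rw [mul_pow, mul_comm]
      _ ≤ ((q + 1) ^ q) ^ x := Nat.pow_le_pow_left hbern x
  · have h1 : x ^ (2 * ℓ + 2) * 2 ^ N < 2 ^ N * m := by
      calc x ^ (2 * ℓ + 2) * 2 ^ N ≤ x ^ (2 * ℓ + 2) * x := by gcongr
        _ = x ^ (2 * ℓ + 3) := by ring
        _ ≤ x ^ N := Nat.pow_le_pow_right hx1 (by rw [hN]; nlinarith)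
        _ < 2 ^ N * m := hpow
    have h2 : x ^ (ℓ + 1) * x ^ (ℓ + 1) = x ^ (2 * ℓ + 2) := by ring
    rw [h2]
    rw [mul_comm] at h1
    exact lt_of_mul_lt_mul_left h1 (Nat.zero_le _)
  · have hy1 : (1 : ℝ) ≤ x / 2 := by
      rw [le_div_iff₀ (by norm_num)]
      have : (2 : ℝ) ≤ x := by exact_mod_cast (show 2 ≤ x by omega)
      linarith
    have hyN : ((x : ℝ) / 2) ^ N ≤ m := by
      rw [div_pow, div_le_iff₀ (by positivity), mul_comm]
      exact_mod_cast hpow.le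
    have hbig : M * (x ^ (ℓ + 1)) ^ (ℓ + 1) * 2 ^ (N + 2 * ℓ + 4) ≤ x ^ (N + 2 * ℓ + 4) := by
      have h1 : M * 2 ^ (N + 2 * ℓ + 4) ≤ x := by omega
      calc M * (x ^ (ℓ + 1)) ^ (ℓ + 1) * 2 ^ (N + 2 * ℓ + 4)
          = M * 2 ^ (N + 2 * ℓ + 4) * x ^ (N + 2 * ℓ + 1) := by rw [hN]; ring
        _ ≤ x * x ^ (N + 2 * ℓ + 1) := by gcongr
        _ = x ^ (N + 2 * ℓ + 2) := by ring
        _ ≤ x ^ (N + 2 * ℓ + 4) := Nat.pow_le_pow_right hx1 (by omega)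
    calc ((M * (x ^ (ℓ + 1)) ^ (ℓ + 1) : ℕ) : ℝ)
        ≤ ((x : ℝ) / 2) ^ (N + 2 * ℓ + 4) := by
          rw [div_pow, le_div_iff₀ (by positivity)]
          exact_mod_cast hbig
      _ = ((x : ℝ) / 2) ^ ((N + 2 * ℓ + 4 : ℕ) : ℝ) := (Real.rpow_natCast _ _).symm
      _ ≤ ((x : ℝ) / 2) ^ ((N : ℝ) * (1 + ε)) := by
          refine Real.rpow_le_rpow_of_exponent_le hy1 ?_
          rw [hN]; push_cast; linarith
      _ = (((x : ℝ) / 2) ^ N) ^ (1 + ε) := by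
          rw [Real.rpow_mul (by positivity), Real.rpow_natCast]
      _ ≤ (m : ℝ) ^ (1 + ε) := Real.rpow_le_rpow (by positivity) hyN (by linarith)

theorem cost_le {R q ℓ : ℕ} {cap : ℕ → ℕ} (hqR : q ≤ R)
    (hcap : ∀ j, cap (j + 1) ≤ 2 ^ ℓ * q ^ j) (k : ℕ) : cost R cap k ≤ k * 2 ^ ℓ * R ^ k := by
  induction k with
  | zero => simp [cost]
  | succ k ih =>
    have h1 : cap (k + 1) ≤ 2 ^ ℓ * R ^ k :=
      (hcap k).trans (Nat.mul_le_mul_left _ (Nat.pow_le_pow_left hqR k))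
    calc cost R cap (k + 1) = R * (cap (k + 1) + cost R cap k) := rfl
      _ ≤ R * (2 ^ ℓ * R ^ k + k * 2 ^ ℓ * R ^ k) := by gcongr
      _ = (k + 1) * 2 ^ ℓ * R ^ (k + 1) := by ring

end SteinerForest

namespace MatrixProgram

open SteinerForest

variable {n : ℕ} {E : Fin n → Fin n → Prop} {T F : Finset (Fin n × Fin n)}

theorem Feasible.reaches (h : Feasible E T F) {s t : Fin n} (hst : (s, t) ∈ T) :
    Reaches F s t := by
  by_contra hr
  have := mem_unsatisfied.2 ⟨hst, hr⟩
  rw [h.2 s] at this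
  exact absurd this (Finset.notMem_empty _)

/-- Every source of a nontrivial pair has an outgoing edge in a solution. -/
theorem Feasible.sourceCount_le (h : Feasible E T F) : sourceCount T ≤ F.card := by
  refine (Finset.card_le_card (t := F.image Prod.fst) fun s hs => ?_).trans Finset.card_image_le
  obtain ⟨t, ht⟩ := (Finset.mem_filter.1 hs).2
  rw [mem_unsatisfied] at ht
  rcases Relation.ReflTransGen.cases_head (h.reaches ht.1) with rfl | ⟨x, hx, -⟩
  · exact absurd .refl ht.2
  · exact Finset.mem_image.2 ⟨_, hx, rfl⟩

/-- Every target of a nontrivial pair has an incoming edge in a solution. -/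
theorem Feasible.card_unsatisfied_le (h : Feasible E T F) (s : Fin n)
    (X : Finset (Fin n × Fin n)) : (unsatisfied T s X).card ≤ F.card := by
  refine (Finset.card_le_card (t := F.image Prod.snd) fun t ht => ?_).trans Finset.card_image_le
  rw [mem_unsatisfied] at ht
  rcases Relation.ReflTransGen.cases_tail (h.reaches ht.1) with rfl | ⟨x, -, hx⟩
  · exact absurd .refl ht.2
  · exact Finset.mem_image.2 ⟨_, hx, rfl⟩

/-- The bounds for the numbers of edges of the arborescences at the levels of the recursion. -/
def capacity (n ℓ q j : ℕ) : ℕ :=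
  if j = 0 then 0 else min (2 ^ (ℓ + 1 - j) * q ^ (j - 1)) (n - 1)

theorem capacity_succ_le (n ℓ q j : ℕ) : capacity n ℓ q (j + 1) ≤ 2 ^ ℓ * q ^ j := by
  rw [capacity, if_neg (by omega)]
  exact (min_le_left _ _).trans
    (Nat.mul_le_mul (Nat.pow_le_pow_right (by omega) (by omega)) le_rfl)

theorem Feasible.admissible (h : Feasible E T F) {d : Fin n → Fin n → ℕ} (hd : IsDistance E d)
    {q R ℓ : ℕ} (hq : F.card ≤ q ^ ℓ) (hℓ : 2 ^ ℓ ≤ q) (hR : q ^ R * F.card < (q + 1) ^ R) :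
    Admissible E d T q R (capacity n ℓ q) (ℓ + 1) where
  splits j hj := by
    rcases j with _ | j
    · refine splits_zero hd ?_
      rw [capacity, if_neg (by omega)]
      refine (min_le_left _ _).trans ?_
      simpa using hℓ
    · have h1 : capacity n ℓ q (j + 1 + 1) = min (q * (2 ^ (ℓ - (j + 1)) * q ^ j)) (n - 1) := by
        rw [capacity, if_neg (by omega), show ℓ + 1 - (j + 1 + 1) = ℓ - (j + 1) by omega,
          show j + 1 + 1 - 1 = j + 1 by omega]
        congr 1; ring
      have h2 : capacity n ℓ q (j + 1) = min (2 * (2 ^ (ℓ - (j + 1)) * q ^ j)) (n - 1) := by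
        rw [capacity, if_neg (by omega), show ℓ + 1 - (j + 1) = ℓ - (j + 1) + 1 by omega,
          show j + 1 - 1 = j by omega]
        congr 1; ring
      rw [h1, h2]
      have hq0 : 0 < q := (Nat.two_pow_pos ℓ).trans_le hℓ
      exact splits_min hd _ (Nat.mul_pos (Nat.two_pow_pos _) (Nat.pow_pos hq0))
  lt_pow s X Y := by
    refine lt_of_le_of_lt (Nat.mul_le_mul_left _ ?_) hR
    exact (Finset.card_le_card Finset.inter_subset_right).trans (h.card_unsatisfied_le s X)
  arborescence s := by
    obtain ⟨c, Y, hA, hc, hcn, hY⟩ := exists_arborescence F h.1 s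
    rw [Fintype.card_fin] at hcn
    refine ⟨c, Y, ?_, hA, fun t ht => hY t (h.reaches (mem_unsatisfied.1 ht).1)⟩
    rw [capacity, if_neg (by omega)]
    refine le_min ?_ (by omega)
    simpa using hc.trans hq

/-- The approximation guarantee, relative to an arbitrary solution `F`. -/
theorem exists_algorithm {ε : ℝ} (hε : 0 < ε) : ∃ S : Cmd, ∀ (n : ℕ) (E : Fin n → Fin n → Prop)
    (T F : Finset (Fin n × Fin n)) (ρ : Env n) (σ : Store n), (∀ u v, σ 0 u v ≠ 0 ↔ E u v) →
    (∀ u v, σ 1 u v ≠ 0 ↔ (u, v) ∈ T) → Feasible E T F →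
    Feasible E T (support (S.run ρ σ 2)) ∧
      ((support (S.run ρ σ 2)).card : ℝ) ≤ (F.card : ℝ) ^ (1 + ε) * F.card := by
  obtain ⟨ℓ, C, h⟩ := exists_parameters hε
  refine ⟨algorithm (ℓ + 1) C, fun n E T F ρ σ hE hT hF => ?_⟩
  have hsub : F ⊆ support (σ 0) := fun ⟨u, v⟩ he => mem_support.2 ((hE u v).2 (hF.1 _ he))
  have hall : Feasible E T (support (σ 0)) :=
    ⟨fun ⟨u, v⟩ he => (hE u v).1 (mem_support.1 he),
      fun s => Finset.subset_empty.1 (hF.2 s ▸ unsatisfied_anti hsub)⟩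
  obtain ⟨d, hd, hout, hsmall, hlarge⟩ := algorithm_run (ℓ + 1) C ρ σ hE hT hall
  refine ⟨hout, ?_⟩
  rcases le_or_gt F.card C with hC | hC
  · rcases Nat.eq_zero_or_pos F.card with h0 | hpos
    · have := hsmall F hF hC
      rw [h0] at this ⊢
      simp [Nat.le_zero.1 this]
    · have h1 : (1 : ℝ) ≤ F.card := by exact_mod_cast hpos
      calc ((support ((algorithm (ℓ + 1) C).run ρ σ 2)).card : ℝ) ≤ F.card := by
            exact_mod_cast hsmall F hF hC
        _ = 1 * F.card := (one_mul _).symm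
        _ ≤ (F.card : ℝ) ^ (1 + ε) * F.card := by
            gcongr
            exact Real.one_le_rpow h1 (by linarith)
  · obtain ⟨q, R, hq, hℓ, hqR, hR, hRm, hcost⟩ := h _ hC
    have hn : 0 < n := (ρ 0).pos
    have hRn : R < n := by
      have : F.card ≤ n * n := (Finset.card_le_univ F).trans (by simp)
      exact lt_of_mul_self_lt_mul_self₀ (Nat.zero_le _) (hRm.trans_le this)
    have hbound := hlarge q R (capacity n ℓ q) hRn
      (fun j => by rw [capacity]; split_ifs <;> omega) (by simp [capacity])
      (hF.admissible hd hq hℓ hR)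
    have hc := cost_le hqR (capacity_succ_le n ℓ q) (ℓ + 1)
    calc ((support ((algorithm (ℓ + 1) C).run ρ σ 2)).card : ℝ)
        ≤ ((F.card * ((ℓ + 1) * 2 ^ ℓ * R ^ (ℓ + 1)) : ℕ) : ℝ) := by
          exact_mod_cast hbound.trans (Nat.mul_le_mul hF.sourceCount_le hc)
      _ = (((ℓ + 1) * 2 ^ ℓ * R ^ (ℓ + 1) : ℕ) : ℝ) * F.card := by
          rw [Nat.cast_mul, mul_comm]
      _ ≤ (F.card : ℝ) ^ (1 + ε) * F.card := by gcongr

/-! ### The machine -/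

open RAM

/-- Fill the array 4 with the multiples of `n`. -/
def multiples : Prog :=
  .forVar (2 * 0 + 1) (2 * 0 + 2) <| .seq (.store 4 (.reg 1) (.reg 4))
    (.assign 4 (.add (.reg 4) (.reg 0)))

theorem runs_multiples {n : ℕ} {s : State} (h0 : s.reg 0 = n) (h4 : s.reg 4 = 0) :
    multiples.Runs s (n * (7 + 8) + 12) fun s' => Frame 0 s s' ∧
      (∀ c j, c ≠ 4 → s'.arr c j = s.arr c j) ∧ ∀ j < n, s'.arr 4 j = j * n := by
  refine (Prog.runs_forVar (n := n) (d := 0) (e := 0) (T := 7) le_rfl h0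
    (fun k s₁ => (∀ c j, c ≠ 4 → s₁.arr c j = s.arr c j) ∧ (∀ j < k, s₁.arr 4 j = j * n) ∧
      s₁.reg 4 = k * n) ?_ ?_ ?_).mono le_rfl fun s' h => ⟨h.1, h.2.1, h.2.2.1⟩
  · rintro k s₁ r v hr ⟨h1, h2, h3⟩
    refine ⟨h1, h2, ?_⟩
    rw [State.setReg_reg, if_neg (by omega), h3]
  · exact ⟨fun _ _ _ => rfl, fun j hj => absurd hj (by omega), by simp [h4]⟩
  · rintro k hk s₁ hf ⟨h1, h2, h3⟩
    have hk1 : s₁.reg 1 = k := by rw [hf 1 (by omega)]; simp [State.setReg_reg]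
    have hn : s₁.reg 0 = n := by
      rw [hf 0 (by omega), State.setReg_reg, if_neg (by omega), h0]
    refine Prog.Runs.seq (T := 3) (T' := 4) (Q := fun s₂ => s₂ = s₁.setArr 4 k (k * n))
      (Prog.runs_store (by simp [Expr.cost]) (by simp [Expr.eval, hk1, h3])) ?_
    rintro _ rfl
    refine Prog.runs_assign (by simp [Expr.cost]) ⟨?_, ?_, ?_, ?_⟩
    · exact ((Frame.refl _ _).setArr _ _ _).setReg (e := 1) le_rfl _
    · intro c j hc
      rw [State.setReg_arr, State.setArr_arr, if_neg (by tauto), h1 c j hc]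
    · intro j hj
      rw [State.setReg_arr, State.setArr_arr]
      split_ifs with h
      · rw [h.2]
      · exact h2 j (by
          have : j ≠ k := fun hjk => h ⟨rfl, hjk⟩
          omega)
    · rw [State.setReg_reg, if_pos rfl]
      simp only [Expr.eval, State.setArr_reg, h3, hn]
      ring

/-- The store which represents an instance. -/
noncomputable def instanceStore {n : ℕ} (I : DirectedSteinerForest (Fin n)) : Store n :=
  fun a u v => I.initialState.arr (slot a) (u * n + v)

theorem matrixArray_apply {n : ℕ} (r : Fin n → Fin n → Prop) (u v : Fin n) :
    matrixArray n r (u * n + v) ≠ 0 ↔ r u v := by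
  unfold matrixArray
  split_ifs with h
  · obtain ⟨u', v', h, h'⟩ := h
    obtain ⟨rfl, rfl⟩ := position_injective h
    simpa using h'
  · simp only [ne_eq, not_true_eq_false, false_iff]
    exact fun hr => h ⟨u, v, rfl, hr⟩

/-- Every matrix program can be executed in polynomial time. -/
theorem exists_prog (S : Cmd) : ∃ (P : Prog) (p : Polynomial ℕ),
    ∀ (n : ℕ) (I : DirectedSteinerForest (Fin n)), P.Runs I.initialState (p.eval n) fun s' =>
      ∀ ρ : Env n, (∀ x, (ρ x : ℕ) = 0) →
        ∀ u v : Fin n, s'.arr 2 (u * n + v) = S.run ρ (instanceStore I) 2 u v := by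
  refine ⟨.cond (.reg 0) (.seq multiples (S.code 0)) .skip,
    2 + ((.X * (7 + 8) + 12) + (S.time + 1)), fun n I => ?_⟩
  have hreg : ∀ x, I.initialState.reg x = if x = 0 then n else 0 := fun x => rfl
  have h := Prog.runs_cond (e := .reg 0) (P := .seq multiples (S.code 0)) (P' := .skip)
    (s := I.initialState) (T := (n * (7 + 8) + 12) + (S.time.eval n + 1)) (Q := fun s' =>
      ∀ ρ : Env n, (∀ x, (ρ x : ℕ) = 0) →
        ∀ u v : Fin n, s'.arr 2 (u * n + v) = S.run ρ (instanceStore I) 2 u v) ?_ ?_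
  · exact h.mono (by simp [Expr.cost]) fun _ h => h
  · intro hn
    have hn' : 0 < n := by simpa [Expr.eval, hreg, Nat.pos_iff_ne_zero] using hn
    refine (runs_multiples (n := n) (by simp [hreg]) (by simp [hreg])).seq ?_
    rintro s₁ ⟨hf, ho, hmul⟩
    set ρ₀ : Env n := fun _ => ⟨0, hn'⟩ with hρ₀
    have hrep : Represents s₁ (instanceStore I) ρ₀ :=
      { size := by rw [hf 0 (by omega)]; simp [hreg]
        var := fun x => by rw [hf _ (by omega)]; simp [hreg, hρ₀]
        mul := fun u => hmul u u.2
        mat := fun a u v => by rw [ho _ _ (slot_ne_four a)]; rfl }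
    refine (Cmd.runs_code S 0 s₁ _ _ hrep).mono (by omega) ?_
    rintro s₂ ⟨h₂, -⟩ ρ hρ u v
    have : ρ = ρ₀ := funext fun x => Fin.ext (hρ x)
    rw [this]
    exact h₂.mat 2 u v
  · intro hn
    -- there are no environments if there are no vertices
    refine ⟨1, _, .skip _, by omega, fun ρ => ?_⟩
    have h0 : n = 0 := by simpa [Expr.eval, hreg] using hn
    exact absurd (ρ 0).2 (by omega)

theorem feasible_iff_isSolution {n : ℕ} (I : DirectedSteinerForest (Fin n))
    (F : Finset (Fin n × Fin n)) : Feasible I.graph.Adj I.terminals F ↔ I.IsSolution F := by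
  constructor
  · exact fun h => ⟨h.1, fun p hp => h.reaches hp⟩
  · refine fun h => ⟨h.1, fun s => Finset.eq_empty_of_forall_notMem fun t ht => ?_⟩
    rw [mem_unsatisfied] at ht
    exact ht.2 (h.2 _ ht.1)

end MatrixProgram

/-- For every `ε > 0` there is an algorithm for Directed Steiner Forest with running time
polynomial in the number `n` of vertices (the input consists of two `n × n` bit matrices) that
returns, in array 2, the matrix of a solution with at most `OPT ^ (1 + ε) * OPT` edges whenever
a solution exists. -/
theorem mainTheorem5 (ε : ℝ) (hε : 0 < ε) :
    ∃ (P : RAM.Prog) (p : Polynomial ℕ),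
      ∀ (n : ℕ) (I : DirectedSteinerForest (Fin n)),
        ∃ (t : ℕ) (s : RAM.State),
          P.Exec I.initialState t s ∧ t ≤ p.eval n ∧
          ((∃ F, I.IsSolution F) →
            I.IsSolution (RAM.pairsOfArray n (s.arr 2)) ∧
            ((RAM.pairsOfArray n (s.arr 2)).card : ℝ) ≤ (I.opt : ℝ) ^ (1 + ε) * (I.opt : ℝ)) := by
  obtain ⟨S, hS⟩ := MatrixProgram.exists_algorithm hε
  obtain ⟨P, p, hP⟩ := MatrixProgram.exists_prog S
  refine ⟨P, p, fun n I => ?_⟩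
  obtain ⟨t, s, hexec, ht, hs⟩ := hP n I
  refine ⟨t, s, hexec, ht, fun hex => ?_⟩
  obtain ⟨F, hF, hopt⟩ : I.opt ∈ {c | ∃ F, I.IsSolution F ∧ F.card = c} :=
    Nat.sInf_mem (by obtain ⟨F, hF⟩ := hex; exact ⟨_, F, hF, rfl⟩)
  rw [← hopt]
  rcases Nat.eq_zero_or_pos n with rfl | hn
  · rw [Subsingleton.elim (RAM.pairsOfArray 0 (s.arr 2)) F]
    refine ⟨hF, ?_⟩
    rw [Subsingleton.elim F ∅]
    simp
  · set ρ : MatrixProgram.Env n := fun _ => ⟨0, hn⟩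
    have hout : RAM.pairsOfArray n (s.arr 2) =
        MatrixProgram.support (S.run ρ (MatrixProgram.instanceStore I) 2) := by
      ext ⟨u, v⟩
      rw [MatrixProgram.mem_support, ← hs ρ (fun _ => rfl)]
      simp [RAM.pairsOfArray]
    obtain ⟨hfeas, hcard⟩ := hS n I.graph.Adj I.terminals F ρ (MatrixProgram.instanceStore I)
      (MatrixProgram.matrixArray_apply _) (MatrixProgram.matrixArray_apply _)
      ((MatrixProgram.feasible_iff_isSolution I F).2 hF)
    rw [hout]
    exact ⟨(MatrixProgram.feasible_iff_isSolution I _).1 hfeas, hcard⟩
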